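/- Let $M$ be a compact connected smooth manifold without boundary, of dimension $m$, with a smooth Riemannian metric $g$, and let $f\in C^\infty(M)$ satisfy $\|\operatorname{grad} f\|^2=g(\operatorname{grad} f,\operatorname{grad} f)<1$ on $M$, where $\operatorname{grad}$ is the gradient with respect to $g$. Then $\tilde g=g-df\otimes df$ is a Riemannian metric on $M$. The identity map $\tilde I_d:(M,\tilde g)\to(M,g)$, $x\mapsto x$, is harmonic if and only if $f$ is constant on $M$. Here a smooth map $\varphi:(M,g)\to(N,h)$ between Riemannian manifolds is called harmonic if its tension field $\tau(\varphi)=\operatorname{trace}_g\nabla d\varphi$ vanishes identically; in local coordinates, $$\tau(\varphi)^\gamma=\sum_{i,j}g^{ij}\Big(\partial_i\partial_j\varphi^\gamma-\sum_k{}^{g}\Gamma^k_{ij}\,\partial_k\varphi^\gamma+\sum_{\alpha,\beta}{}^{h}\Gamma^\gamma_{\alpha\beta}(\varphi)\,\partial_i\varphi^\alpha\,\partial_j\varphi^\beta\Big),$$ where ${}^{g}\Gamma$ and ${}^{h}\Gamma$ are the Christoffel symbols of the Levi-Civita connections of $g$ and $h$. -/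

import Mathlib

open scoped Manifold ContDiff

noncomputable section

namespace RiemHarmonic

/-- A smooth Riemannian metric on an `m`-dimensional smooth manifold. -/
abbrev Metric (m : ℕ) (M : Type*) [TopologicalSpace M] [ChartedSpace (EuclideanSpace ℝ (Fin m)) M]
    [IsManifold (𝓡 m) ∞ M] :=
  Bundle.ContMDiffRiemannianMetric (𝓡 m) ∞ (EuclideanSpace ℝ (Fin m))
    (fun x : M => TangentSpace (𝓡 m) x)

/-- Partial derivative in the `i`-th coordinate of a real function on `ℝᵐ`. -/
def pderiv {m : ℕ} (i : Fin m) (h : EuclideanSpace ℝ (Fin m) → ℝ)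
    (y : EuclideanSpace ℝ (Fin m)) : ℝ :=
  fderiv ℝ h y (EuclideanSpace.single i 1)

section Local

variable {m : ℕ} {M : Type*} [TopologicalSpace M] [ChartedSpace (EuclideanSpace ℝ (Fin m)) M]

/-- The coordinate vector `∂ᵢ` of the preferred chart at `p`, at the point whose coordinates are
`y`. -/
def coordVec (p : M) (i : Fin m) (y : EuclideanSpace ℝ (Fin m)) :
    TangentSpace (𝓡 m) ((extChartAt (𝓡 m) p).symm y) :=
  mfderiv (𝓡 m) (𝓡 m) (extChartAt (𝓡 m) p).symm y
    (EuclideanSpace.single i (1 : ℝ) : EuclideanSpace ℝ (Fin m))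

/-- The symmetric tensor `df ⊗ df`. -/
def dfdf (f : M → ℝ) (x : M) : TangentSpace (𝓡 m) x →L[ℝ] TangentSpace (𝓡 m) x →L[ℝ] ℝ :=
  (mvfderiv (𝓡 m) f x).smulRight (mvfderiv (𝓡 m) f x)

theorem dfdf_apply (f : M → ℝ) (x : M) (v w : TangentSpace (𝓡 m) x) :
    dfdf f x v w = mvfderiv (𝓡 m) f x v * mvfderiv (𝓡 m) f x w := rfl

variable [IsManifold (𝓡 m) ∞ M]

/-- The matrix `(gᵢⱼ)` of the metric in the preferred chart at `p`, as a function of the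
coordinates. -/
def gram (g : Metric m M) (p : M) (y : EuclideanSpace ℝ (Fin m)) : Matrix (Fin m) (Fin m) ℝ :=
  Matrix.of fun i j =>
    g.inner ((extChartAt (𝓡 m) p).symm y) (coordVec p i y) (coordVec p j y)

/-- The Christoffel symbol `Γᵏᵢⱼ` of the Levi-Civita connection of `g`, in the preferred chart at
`p`. -/
def christoffel (g : Metric m M) (p : M) (k i j : Fin m) (y : EuclideanSpace ℝ (Fin m)) : ℝ :=
  1 / 2 * ∑ l, (gram g p y)⁻¹ k l *
    (pderiv i (fun z => gram g p z j l) y + pderiv j (fun z => gram g p z i l) y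
      - pderiv l (fun z => gram g p z i j) y)

end Local

section Tension

variable {m n : ℕ} {M N : Type*}
  [TopologicalSpace M] [ChartedSpace (EuclideanSpace ℝ (Fin m)) M] [IsManifold (𝓡 m) ∞ M]
  [TopologicalSpace N] [ChartedSpace (EuclideanSpace ℝ (Fin n)) N] [IsManifold (𝓡 n) ∞ N]

/-- The component `(∇dφ)^γ(∂ᵢ, ∂ⱼ)` at `x` of the second fundamental form of `φ : (M, g) → (N, h)`,
in the preferred charts at `x` and at `φ x`; here `∇` is induced by the Levi-Civita connection of
`g` and the pull-back by `φ` of the Levi-Civita connection of `h`. -/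
def secondFundForm (g : Metric m M) (h : Metric n N) (φ : M → N) (x : M) (γ : Fin n)
    (i j : Fin m) : ℝ :=
  let F : EuclideanSpace ℝ (Fin m) → EuclideanSpace ℝ (Fin n) :=
    writtenInExtChartAt (𝓡 m) (𝓡 n) x φ
  let y : EuclideanSpace ℝ (Fin m) := extChartAt (𝓡 m) x x
  pderiv i (pderiv j (fun z => F z γ)) y
    - ∑ k, christoffel g x k i j y * pderiv k (fun z => F z γ) y
    + ∑ α, ∑ β, christoffel h (φ x) γ α β (F y) *
        pderiv i (fun z => F z α) y * pderiv j (fun z => F z β) y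

/-- The component `τ(φ)^γ = gⁱʲ (∇dφ)^γ(∂ᵢ, ∂ⱼ)` of the tension field at `x`. -/
def tensionCoord (g : Metric m M) (h : Metric n N) (φ : M → N) (x : M) (γ : Fin n) : ℝ :=
  ∑ i, ∑ j, (gram g x (extChartAt (𝓡 m) x x))⁻¹ i j * secondFundForm g h φ x γ i j

/-- The tension field `τ(φ) = trace_g ∇dφ`, a vector field along `φ`. The value at `x` is the
combination of the coordinate vectors at `φ x` of the preferred chart at `φ x`; since the tangent
space at a point is identified with the model space by the preferred chart at this point, these
coordinate vectors are the standard basis vectors. -/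
def tension (g : Metric m M) (h : Metric n N) (φ : M → N) (x : M) : TangentSpace (𝓡 n) (φ x) :=
  (WithLp.toLp 2 (tensionCoord g h φ x) : EuclideanSpace ℝ (Fin n))

/-- A smooth map `φ : (M, g) → (N, h)` is harmonic if its tension field vanishes. -/
def IsHarmonicMap (g : Metric m M) (h : Metric n N) (φ : M → N) : Prop :=
  ContMDiff (𝓡 m) (𝓡 n) ∞ φ ∧ ∀ x, tension g h φ x = 0

end Tension

section Deformation

variable {m : ℕ} {M : Type*} [TopologicalSpace M] [ChartedSpace (EuclideanSpace ℝ (Fin m)) M]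
  [IsManifold (𝓡 m) ∞ M]

instance finiteDimensional_tangentSpace (x : M) : FiniteDimensional ℝ (TangentSpace (𝓡 m) x) :=
  inferInstanceAs (FiniteDimensional ℝ (EuclideanSpace ℝ (Fin m)))

/-- The inner product `g_x` as a bilinear form. -/
def bilin (g : Metric m M) (x : M) : LinearMap.BilinForm ℝ (TangentSpace (𝓡 m) x) :=
  LinearMap.mk₂ ℝ (fun v w => g.inner x v w) (by simp) (by simp) (by simp) (by simp)

theorem bilin_nondegenerate (g : Metric m M) (x : M) : (bilin g x).Nondegenerate := by
  refine ⟨fun v hv => ?_, fun v hv => ?_⟩ <;>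
  · by_contra h
    exact (g.pos x v h).ne' (hv v)

/-- The gradient of `f` with respect to `g`: the vector field with `g(grad f, v) = df(v)`. -/
def grad (g : Metric m M) (f : M → ℝ) (x : M) : TangentSpace (𝓡 m) x :=
  ((bilin g x).toDual (bilin_nondegenerate g x)).symm (mvfderiv (𝓡 m) f x).toLinearMap

theorem inner_grad (g : Metric m M) (f : M → ℝ) (x : M) (v : TangentSpace (𝓡 m) x) :
    g.inner x (grad g f x) v = mvfderiv (𝓡 m) f x v := by
  have := LinearMap.BilinForm.apply_toDual_symm_apply (hB := bilin_nondegenerate g x)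
    (mvfderiv (𝓡 m) f x).toLinearMap v
  exact this

/-- `df(v)² ≤ ‖grad f‖² ‖v‖²`. -/
theorem sq_mvfderiv_le (g : Metric m M) (f : M → ℝ) (x : M) (v : TangentSpace (𝓡 m) x) :
    mvfderiv (𝓡 m) f x v * mvfderiv (𝓡 m) f x v ≤
      g.inner x (grad g f x) (grad g f x) * g.inner x v v := by
  have hnn : ∀ w, 0 ≤ g.inner x w w := fun w => by
    by_cases h : w = 0
    · simp [h]
    · exact (g.pos x w h).le
  set a := g.inner x (grad g f x) (grad g f x) with ha
  set b := mvfderiv (𝓡 m) f x v with hb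
  have h1 := hnn (g.inner x v v • grad g f x - b • v)
  have h2 : g.inner x v (grad g f x) = b := by rw [g.symm, inner_grad]
  simp only [map_sub, map_smul, sub_apply, smul_apply,
    smul_eq_mul, ← ha, inner_grad, h2, ← hb] at h1
  by_cases hv : v = 0
  · simp [hb, hv]
  · have := g.pos x v hv
    have h3 : 0 ≤ g.inner x v v * (a * g.inner x v v - b * b) := by nlinarith
    have := nonneg_of_mul_nonneg_right h3 this
    linarith

theorem contDiff_smulRight_self (V : Type*) [NormedAddCommGroup V] [NormedSpace ℝ V] :
    ContDiff ℝ ∞ (fun L : V →L[ℝ] ℝ => (L.smulRight L : V →L[ℝ] V →L[ℝ] ℝ)) :=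
  contDiff_id.smulRight contDiff_id

theorem contMDiff_dfdf {f : M → ℝ} (hf : ContMDiff (𝓡 m) 𝓘(ℝ, ℝ) ∞ f) :
    ContMDiff (𝓡 m) ((𝓡 m).prod 𝓘(ℝ, EuclideanSpace ℝ (Fin m) →L[ℝ]
        EuclideanSpace ℝ (Fin m) →L[ℝ] ℝ)) ∞
      (fun x : M => Bundle.TotalSpace.mk' (EuclideanSpace ℝ (Fin m) →L[ℝ]
        EuclideanSpace ℝ (Fin m) →L[ℝ] ℝ)
        (E := fun x : M => TangentSpace (𝓡 m) x →L[ℝ] TangentSpace (𝓡 m) x →L[ℝ] ℝ)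
        x (dfdf f x)) := by
  intro x₀
  have h1 := (hf x₀).mfderiv_const (m := ∞) (by simp)
  let L : M → EuclideanSpace ℝ (Fin m) →L[ℝ] ℝ :=
    inTangentCoordinates (𝓡 m) 𝓘(ℝ, ℝ) id f (mfderiv (𝓡 m) 𝓘(ℝ, ℝ) f) x₀
  have hL : ContMDiffAt (𝓡 m) 𝓘(ℝ, EuclideanSpace ℝ (Fin m) →L[ℝ] ℝ) ∞ L x₀ := h1
  rw [Bundle.contMDiffAt_section]
  have hS := ((contDiff_smulRight_self (EuclideanSpace ℝ (Fin m))).contMDiff.contMDiffAt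
    (x := L x₀)).comp x₀ hL
  refine hS.congr_of_eventuallyEq ?_
  filter_upwards [(trivializationAt (EuclideanSpace ℝ (Fin m)) (TangentSpace (𝓡 m))
    x₀).open_baseSet.mem_nhds (FiberBundle.mem_baseSet_trivializationAt _ _ x₀)] with x hx
  ext v w
  refine (inCoordinates_apply_eq₂ (E₃ := Bundle.Trivial M ℝ) hx hx (by simp)).trans ?_
  have key : ∀ u, L x u = mvfderiv (𝓡 m) f x
      ((trivializationAt (EuclideanSpace ℝ (Fin m)) (TangentSpace (𝓡 m)) x₀).symm x u) := by
    intro u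
    change ContinuousLinearMap.inCoordinates (EuclideanSpace ℝ (Fin m)) (TangentSpace (𝓡 m)) ℝ
      (TangentSpace 𝓘(ℝ, ℝ)) x₀ x (f x₀) (f x) (mfderiv (𝓡 m) 𝓘(ℝ, ℝ) f x) u = _
    have hy : f x ∈ (trivializationAt ℝ (TangentSpace 𝓘(ℝ, ℝ)) (f x₀)).baseSet := by
      simp [chartAt_self_eq]
    rw [ContinuousLinearMap.inCoordinates_eq hx hy]
    simp only [ContinuousLinearMap.comp_apply, ContinuousLinearEquiv.coe_coe,
      Bundle.Trivialization.coe_continuousLinearEquivAt_eq,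
      Bundle.Trivialization.symm_continuousLinearEquivAt_eq, mvfderiv,
      TangentBundle.continuousLinearMapAt_model_space]
    rw [Bundle.Trivialization.symmL_apply _ hx]
    rfl
  simp [key, dfdf_apply]

/-- The deformed metric `g - df ⊗ df`, a Riemannian metric because `‖grad f‖ < 1`. -/
def deform (g : Metric m M) (f : M → ℝ) (hf : ContMDiff (𝓡 m) 𝓘(ℝ, ℝ) ∞ f)
    (hlt : ∀ x, g.inner x (grad g f x) (grad g f x) < 1) : Metric m M where
  inner x := g.inner x - dfdf f x
  symm x v w := by
    simp only [sub_apply, dfdf_apply, g.symm x v w, mul_comm]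
  pos x v hv := by
    have h1 := sq_mvfderiv_le g f x v
    have h2 := g.pos x v hv
    simp only [sub_apply, dfdf_apply]
    nlinarith [hlt x]
  isVonNBounded x := by
    set c := 1 - g.inner x (grad g f x) (grad g f x) with hc
    have hc0 : 0 < c := by linarith [hlt x]
    have hr : 0 < √c := Real.sqrt_pos.2 hc0
    refine ((g.isVonNBounded x).image
      ((√c)⁻¹ • ContinuousLinearMap.id ℝ (TangentSpace (𝓡 m) x))).subset ?_
    intro v hv
    refine ⟨√c • v, ?_, ?_⟩
    · have h1 := sq_mvfderiv_le g f x v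
      have h3 : √c * √c = c := Real.mul_self_sqrt hc0.le
      simp only [Set.mem_ofPred_eq, sub_apply, dfdf_apply, map_smul, smul_apply,
        smul_eq_mul] at hv ⊢
      rw [← mul_assoc, h3, hc]
      nlinarith
    · simp [smul_smul, hr.ne']
  contMDiff := g.contMDiff.sub_section (contMDiff_dfdf hf)

end Deformation

end RiemHarmonic

end

/-! Write g̃ = g - df ⊗ df. For the identity map the second derivatives drop out of the second
fundamental form, which becomes the difference Γ(g) - Γ(g̃) of Christoffel symbols. The symbols of
the first kind of g̃ are those of g minus ∂ᵢ∂ⱼf ∂ₗf (`koszul_sub_mul`). Since g̃ is a rank one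
perturbation of g, raising the index turns this into Γ(g) - Γ(g̃) = Hess_g f · grad_g̃ f
(`christoffel_sub_christoffel_deform`). Hence the tension field is (tr_g̃ Hess_g f) grad_g̃ f, and
it vanishes at a point iff df = 0 or tr_g̃ Hess_g f = 0 there (`tension_deform_eq_zero_iff`).
Constant f gives the easy direction.

Conversely, in a chart tr_g̃ Hess_g f is an elliptic operator without zeroth order term, applied to
f. The equation is available only off the critical points, but Hopf's argument evaluates it only at
a point where the gradient is a nonzero multiple of the gradient of the barrier. So the strong
maximum principle survives (`eventuallyEq_const_of_max`), and the set where f attains its maximum is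
open. It is also closed, and by compactness nonempty, hence all of the connected M.

The tension field at x is expressed in the preferred chart at x, whereas the maximum principle needs
the equation throughout one chart. The invariance of the trace of the Hessian under transition maps
(`traceHess_transition`) bridges the two. -/

noncomputable section

namespace RiemHarmonic

open Set Filter Topology Metric
open scoped MatrixOrder

/-! ### Second derivative test at a local maximum -/

section SecondDerivativeTest

variable {E : Type*} [NormedAddCommGroup E] [NormedSpace ℝ E]

/-- At a local maximum the second derivative is negative semidefinite. -/
theorem fderiv_fderiv_apply_self_nonpos {v : E → ℝ} {z : E} (hv : ContDiffAt ℝ 2 v z)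
    (hmax : IsLocalMax v z) (b : E) : fderiv ℝ (fderiv ℝ v) z b b ≤ 0 := by
  by_contra! hpos
  set c : ℝ → E := fun t => z + t • b with hc
  have hc0 : c 0 = z := by simp [hc]
  have hcd : ∀ t, HasDerivAt c b t := fun t => by
    simpa [hc] using ((hasDerivAt_id t).smul_const b).const_add z
  have hct : Tendsto c (𝓝 0) (𝓝 z) := by
    simpa [hc0] using (hcd 0).continuousAt.tendsto
  have hdiff : ∀ᶠ y in 𝓝 z, DifferentiableAt ℝ v y :=
    (hv.eventually (by simp)).mono fun y hy => hy.differentiableAt (by simp)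
  have hd1 : deriv (v ∘ c) =ᶠ[𝓝 0] fun t => fderiv ℝ v (c t) b := by
    filter_upwards [hct.eventually hdiff] with t ht
    exact (ht.hasFDerivAt.comp_hasDerivAt t (hcd t)).deriv
  have hd2 : HasDerivAt (fun t => fderiv ℝ v (c t) b) (fderiv ℝ (fderiv ℝ v) z b b) 0 := by
    have h1 : HasFDerivAt (fderiv ℝ v) (fderiv ℝ (fderiv ℝ v) z) (c 0) := by
      rw [hc0]
      exact ((hv.fderiv_right (m := 1) (by norm_num)).differentiableAt (by simp)).hasFDerivAt
    have h2 := h1.comp_hasDerivAt 0 (hcd 0)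
    simpa using h2.clm_apply (hasDerivAt_const (0 : ℝ) b)
  have hdd : deriv (deriv (v ∘ c)) 0 = fderiv ℝ (fderiv ℝ v) z b b := by
    rw [hd1.deriv_eq, hd2.deriv]
  have hlocmax : IsLocalMax (v ∘ c) 0 := by
    have h := hct.eventually hmax
    filter_upwards [h] with t ht
    simpa [hc0] using ht
  -- A positive second derivative along the line makes 0 a local minimum as well; being also a local
  -- maximum, it forces `v ∘ c` to be locally constant, with zero second derivative.
  have hlocmin : IsLocalMin (v ∘ c) 0 := by
    refine isLocalMin_of_deriv_deriv_pos (by rwa [hdd]) hlocmax.deriv_eq_zero ?_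
    refine ContinuousAt.comp ?_ (hcd 0).continuousAt
    rw [hc0]
    exact hv.continuousAt
  have hconst : (v ∘ c) =ᶠ[𝓝 0] fun _ => (v ∘ c) 0 := by
    filter_upwards [hlocmax, hlocmin] with t h1 h2
    exact le_antisymm h1 h2
  have h0 : deriv (deriv (v ∘ c)) 0 = 0 := by
    rw [hconst.deriv.deriv_eq]
    simp
  exact hpos.ne' (hdd ▸ h0)

/-- The trace of a negative semidefinite form against a positive semidefinite matrix. -/
theorem sum_mul_bilin_nonpos {ι : Type*} [Fintype ι] {a : Matrix ι ι ℝ}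
    (ha : a.PosSemidef) (Q : E →L[ℝ] E →L[ℝ] ℝ) (hQ : ∀ b, Q b b ≤ 0) (e : ι → E) :
    ∑ i, ∑ j, a i j * Q (e i) (e j) ≤ 0 := by
  classical
  -- Factoring `a` as BᵀB turns the double sum into a sum of values of `Q` on the diagonal.
  obtain ⟨B, hB⟩ := CStarAlgebra.nonneg_iff_eq_star_mul_self.mp ha.nonneg
  rw [Matrix.star_eq_conjTranspose] at hB
  subst hB
  have : ∑ i, ∑ j, (B.conjTranspose * B) i j * Q (e i) (e j)
      = ∑ k, Q (∑ i, B k i • e i) (∑ i, B k i • e i) := by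
    simp only [Matrix.mul_apply, Matrix.conjTranspose_apply, star_trivial, map_sum, map_smul,
      sum_apply, smul_apply, smul_eq_mul, Finset.sum_mul, Finset.mul_sum]
    rw [Finset.sum_comm]
    simp_rw [fun y : ι => Finset.sum_comm (s := Finset.univ (α := ι)) (t := Finset.univ (α := ι))
      (f := fun x k => B k x * B k y * Q (e x) (e y))]
    rw [Finset.sum_comm]
    refine Finset.sum_congr rfl fun k _ => Finset.sum_congr rfl fun j _ =>
      Finset.sum_congr rfl fun i _ => ?_
    ring
  rw [this]
  exact Finset.sum_nonpos fun k _ => hQ _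

end SecondDerivativeTest

/-! ### Derivatives of the Gaussian barrier -/

section Barrier

variable {E : Type*} [NormedAddCommGroup E] [InnerProductSpace ℝ E]

/-- The Gaussian barrier of the maximum principle. -/
def barrier (α : ℝ) (c : E) (r : ℝ) (y : E) : ℝ :=
  Real.exp (-α * ‖y - c‖ ^ 2) - Real.exp (-α * r ^ 2)

theorem contDiff_barrier (α : ℝ) (c : E) (r : ℝ) : ContDiff ℝ ∞ (barrier α c r) := by
  unfold barrier
  have : ContDiff ℝ ∞ fun y : E => ‖y - c‖ ^ 2 := (contDiff_id.sub contDiff_const).norm_sq ℝ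
  fun_prop

theorem hasFDerivAt_exp_norm_sq (α : ℝ) (c y : E) :
    HasFDerivAt (fun y : E => Real.exp (-α * ‖y - c‖ ^ 2))
      ((-2 * α * Real.exp (-α * ‖y - c‖ ^ 2)) • innerSL ℝ (y - c)) y := by
  have h := (((hasFDerivAt_id y).sub_const c).norm_sq.const_mul (-α)).exp
  refine h.congr_fderiv ?_
  ext u
  simp
  ring

theorem fderiv_barrier (α : ℝ) (c : E) (r : ℝ) :
    fderiv ℝ (barrier α c r) =
      fun y => (-2 * α * Real.exp (-α * ‖y - c‖ ^ 2)) • innerSL ℝ (y - c) := by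
  ext1 y
  exact ((hasFDerivAt_exp_norm_sq α c y).sub_const _).fderiv

theorem fderiv_fderiv_barrier (α : ℝ) (c : E) (r : ℝ) (y u v : E) :
    fderiv ℝ (fderiv ℝ (barrier α c r)) y u v =
      Real.exp (-α * ‖y - c‖ ^ 2) *
        (4 * α ^ 2 * (inner ℝ (y - c) u * inner ℝ (y - c) v) - 2 * α * inner ℝ u v) := by
  rw [fderiv_barrier]
  have h1 := (hasFDerivAt_exp_norm_sq α c y).const_mul (-2 * α)
  have h2 : HasFDerivAt (fun y : E => innerSL ℝ (y - c)) (innerSL ℝ : E →L[ℝ] E →L[ℝ] ℝ) y :=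
    (innerSL ℝ : E →L[ℝ] E →L[ℝ] ℝ).hasFDerivAt.comp y ((hasFDerivAt_id y).sub_const c)
  have h3 := (h1.smul h2).fderiv
  rw [show (fun y : E => (-2 * α * Real.exp (-α * ‖y - c‖ ^ 2)) • innerSL ℝ (y - c)) =
    (fun y : E => -2 * α * Real.exp (-α * ‖y - c‖ ^ 2)) • fun y : E => innerSL ℝ (y - c) from rfl, h3]
  have h4 : (innerSL ℝ : E →L[ℝ] E →L[ℝ] ℝ) u v = inner ℝ u v := rfl
  simp only [add_apply, smul_apply, ContinuousLinearMap.smulRight_apply, innerSL_apply_apply,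
    smul_eq_mul, h4]
  ring

end Barrier

end RiemHarmonic

end

noncomputable section

namespace RiemHarmonic

open Set Filter Topology Metric
open scoped MatrixOrder

/-! ### Hopf's strong maximum principle -/

section StrongMaximumPrinciple

variable {m : ℕ}

local notation "𝔼" => EuclideanSpace ℝ (Fin m)

/-- The second order operator with leading coefficients `a` and drift `b`. -/
def ellipticOp (a : 𝔼 → Matrix (Fin m) (Fin m) ℝ) (b : 𝔼 → 𝔼) (F : 𝔼 → ℝ) (y : 𝔼) : ℝ :=
  ∑ i, ∑ j, a y i j *
      fderiv ℝ (fderiv ℝ F) y (EuclideanSpace.single i 1) (EuclideanSpace.single j 1)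
    + fderiv ℝ F y (b y)

/-- The factored form shows the role of `α`: away from `c` the quadratic form is positive when `a y`
is positive definite, and it outweighs the trace and drift terms once `α` is large. -/
theorem ellipticOp_barrier (a : 𝔼 → Matrix (Fin m) (Fin m) ℝ) (b : 𝔼 → 𝔼) (α : ℝ) (c : 𝔼) (r : ℝ)
    (y : 𝔼) :
    ellipticOp a b (barrier α c r) y = Real.exp (-α * ‖y - c‖ ^ 2) * (2 * α) *
      (2 * α * ∑ i, ∑ j, a y i j * ((y - c) i * (y - c) j) -
        ((a y).trace + inner ℝ (y - c) (b y))) := by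
  have key : ∀ i j : Fin m, inner ℝ (EuclideanSpace.single i (1 : ℝ) : 𝔼)
      (EuclideanSpace.single j (1 : ℝ)) = if i = j then (1 : ℝ) else 0 := by
    intro i j
    simp [EuclideanSpace.inner_single_left]
  have key2 : ∀ i : Fin m, inner ℝ (y - c) (EuclideanSpace.single i (1 : ℝ) : 𝔼) = (y - c) i := by
    intro i
    simp only [EuclideanSpace.inner_single_right, one_mul, conj_trivial]
  simp only [ellipticOp, fderiv_fderiv_barrier, key, key2]
  rw [fderiv_barrier]
  simp only [smul_apply, innerSL_apply_apply, smul_eq_mul]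
  have h1 : ∀ i j : Fin m, a y i j * (Real.exp (-α * ‖y - c‖ ^ 2) *
      (4 * α ^ 2 * ((y - c) i * (y - c) j) - 2 * α * if i = j then 1 else 0)) =
      Real.exp (-α * ‖y - c‖ ^ 2) * (4 * α ^ 2) * (a y i j * ((y - c) i * (y - c) j)) -
      Real.exp (-α * ‖y - c‖ ^ 2) * (2 * α) * (if i = j then a y i j else 0) := by
    intro i j
    split_ifs <;> ring
  simp only [h1, Finset.sum_sub_distrib, ← Finset.mul_sum, Finset.sum_ite_eq, Finset.mem_univ,
    if_true, Matrix.trace, Matrix.diag_apply]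
  ring

theorem sum_mul_self_pos {a : Matrix (Fin m) (Fin m) ℝ} (ha : a.PosDef) {u : 𝔼} (hu : u ≠ 0) :
    0 < ∑ i, ∑ j, a i j * (u i * u j) := by
  have h := ha.dotProduct_mulVec_pos (x := u.ofLp) (by simpa using hu)
  simp only [star_trivial, dotProduct, Matrix.mulVec, Finset.mul_sum] at h
  refine h.trans_eq (Finset.sum_congr rfl fun i _ => Finset.sum_congr rfl fun j _ => ?_)
  ring

/-- A subsolution cannot attain its maximum at a single point of a closed ball, on its boundary. -/
theorem false_of_max_touches_ball {Ω : Set 𝔼} (hΩ : IsOpen Ω) {F : 𝔼 → ℝ} (hF : ContDiffOn ℝ 2 F Ω)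
    {a : 𝔼 → Matrix (Fin m) (Fin m) ℝ} (ha : ContinuousOn a Ω) (hpos : ∀ y ∈ Ω, (a y).PosDef)
    {b : 𝔼 → 𝔼} (hb : ContinuousOn b Ω)
    (hL : ∀ y ∈ Ω, fderiv ℝ F y = 0 ∨ ellipticOp a b F y = 0)
    {c p : 𝔼} (hp : p ∈ Ω) (hpc : p ≠ c) (hmax : ∀ y ∈ Ω, F y ≤ F p)
    (hball : ∀ y ∈ Ω, y ∈ closedBall c (dist p c) → y ≠ p → F y < F p) : False := by
  set R := dist p c with hR
  have hR0 : 0 < R := dist_pos.2 hpc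
  obtain ⟨ρ', hρ', hsub'⟩ := Metric.isOpen_iff.1 hΩ p hp
  -- The bound `ρ' / 2` keeps the small closed ball inside `Ω`; `R / 2` keeps it away from `c`,
  -- where the quadratic form `A` and the gradient of the barrier vanish.
  set ρ := min (ρ' / 2) (R / 2) with hρ
  have hρ0 : 0 < ρ := by positivity
  have hρR : ρ < R := (min_le_right _ _).trans_lt (by linarith)
  have hK : closedBall p ρ ⊆ Ω := (closedBall_subset_ball
    ((min_le_left _ _).trans_lt (by linarith))).trans hsub'
  have hKc : IsCompact (closedBall p ρ) := isCompact_closedBall p ρ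
  have hne : ∀ y ∈ closedBall p ρ, y - c ≠ 0 := by
    intro y hy h0
    rw [sub_eq_zero] at h0
    rw [h0, mem_closedBall, dist_comm] at hy
    linarith
  set A : 𝔼 → ℝ := fun y => ∑ i, ∑ j, a y i j * ((y - c) i * (y - c) j) with hA
  set T : 𝔼 → ℝ := fun y => (a y).trace + inner ℝ (y - c) (b y) with hT
  have hApos : ∀ y ∈ closedBall p ρ, 0 < A y := fun y hy =>
    sum_mul_self_pos (hpos y (hK hy)) (hne y hy)
  have hac : ∀ i j, ContinuousOn (fun y => a y i j) (closedBall p ρ) := fun i j =>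
    (continuous_apply_apply i j).comp_continuousOn (ha.mono hK)
  have hyc : ∀ i, Continuous (fun y : 𝔼 => (y - c) i) := fun i => by fun_prop
  have hAc : ContinuousOn A (closedBall p ρ) :=
    continuousOn_finsetSum _ fun i _ => continuousOn_finsetSum _ fun j _ =>
      (hac i j).mul ((hyc i).mul (hyc j)).continuousOn
  have hTc : ContinuousOn T (closedBall p ρ) := by
    refine ContinuousOn.add ?_ (ContinuousOn.inner (by fun_prop) (hb.mono hK))
    exact continuousOn_finsetSum _ fun i _ => hac i i
  -- By compactness T ≤ α₀ A on the small ball. Any positive α > α₀ then gives T < αA < 2αA, so the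
  -- operator is positive on the barrier.
  obtain ⟨α₀, hα₀⟩ := (hKc.image_of_continuousOn
    (hTc.div hAc fun y hy => (hApos y hy).ne')).bddAbove
  set α := max α₀ 0 + 1 with hα
  have hαpos : 0 < α := by positivity
  have hw : ∀ y ∈ closedBall p ρ, 0 < ellipticOp a b (barrier α c R) y := by
    intro y hy
    rw [ellipticOp_barrier]
    have h1 : T y / A y ≤ α₀ := hα₀ (mem_image_of_mem _ hy)
    rw [div_le_iff₀ (hApos y hy)] at h1
    have h2 : α₀ < α := (le_max_left _ _).trans_lt (by linarith)
    have h3 : 0 < 2 * α * A y - T y := by nlinarith [hApos y hy]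
    positivity
  set w := barrier α c R with hwdef
  have hwp : w p = 0 := by
    rw [hwdef, barrier, hR, dist_eq_norm, sub_self]
  have hwneg : ∀ y, R < dist y c → w y < 0 := by
    intro y hy
    rw [hwdef, barrier, sub_neg, Real.exp_lt_exp, dist_eq_norm] at *
    have : R ^ 2 < ‖y - c‖ ^ 2 := by gcongr
    nlinarith
  have hwc : Continuous w := (contDiff_barrier α c R).continuous
  have hFc : ContinuousOn F (closedBall p ρ) := hF.continuousOn.mono hK
  -- the part of the small sphere lying in the ball of the barrier
  obtain ⟨ε, hε, hεS⟩ : ∃ ε : ℝ, 0 < ε ∧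
      ∀ y ∈ sphere p ρ ∩ closedBall c R, F y + ε * w y < F p := by
    have hS : IsCompact (sphere p ρ ∩ closedBall c R) :=
      (isCompact_sphere p ρ).inter_right isClosed_closedBall
    have hSK : sphere p ρ ∩ closedBall c R ⊆ closedBall p ρ :=
      inter_subset_left.trans sphere_subset_closedBall
    have hgap : ∀ y ∈ sphere p ρ ∩ closedBall c R, 0 < F p - F y := by
      intro y hy
      have : y ≠ p := by
        rintro rfl
        have := hy.1
        rw [mem_sphere, dist_self] at this
        exact hρ0.ne this
      linarith [hball y (hK (hSK hy)) hy.2 this]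
    -- The gap `F p - F y` is positive on this compact set, so `w` is at most `B` times the gap.
    -- Using `max B 0 + 1` makes the inverse positive and the inequality strict.
    obtain ⟨B, hB⟩ := (hS.image_of_continuousOn (hwc.continuousOn.div
      ((continuousOn_const (c := F p)).sub (hFc.mono hSK)) fun y hy => (hgap y hy).ne')).bddAbove
    refine ⟨(max B 0 + 1)⁻¹, by positivity, fun y hy => ?_⟩
    have h1 : w y / (F p - F y) ≤ B := hB (mem_image_of_mem _ hy)
    rw [div_le_iff₀ (hgap y hy)] at h1
    have h2 : B < max B 0 + 1 := (le_max_left _ _).trans_lt (by linarith)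
    have h3 : w y < (F p - F y) * (max B 0 + 1) := by nlinarith [hgap y hy]
    have h4 : (max B 0 + 1)⁻¹ * w y < F p - F y := by
      rwa [inv_mul_lt_iff₀' (by positivity)]
    linarith
  have hsphere : ∀ y ∈ sphere p ρ, F y + ε * w y < F p := by
    intro y hy
    by_cases h : y ∈ closedBall c R
    · exact hεS y ⟨hy, h⟩
    · have h1 := hwneg y (by simpa using h)
      have h2 := hmax y (hK (sphere_subset_closedBall hy))
      nlinarith
  -- The perturbed function equals `F p` at `p` and is smaller on the sphere, so its maximum over
  -- the small ball is interior.
  obtain ⟨z, hz, hzmax⟩ := hKc.exists_isMaxOn ⟨p, mem_closedBall_self hρ0.le⟩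
    (hFc.add (hwc.continuousOn.const_smul ε))
  have hzball : z ∈ ball p ρ := by
    rw [← ball_union_sphere] at hz
    refine hz.resolve_right fun h => ?_
    have h1 := hsphere z h
    have h2 := hzmax (mem_closedBall_self hρ0.le)
    simp [hwp] at h2
    linarith
  have hlm : IsLocalMax (F + ε • w) z :=
    hzmax.isLocalMax (mem_of_superset (isOpen_ball.mem_nhds hzball) ball_subset_closedBall)
  have hzΩ : z ∈ Ω := hK hz
  have hF2 : ContDiffAt ℝ 2 F z := hF.contDiffAt (hΩ.mem_nhds hzΩ)
  have hw2 : ContDiff ℝ 2 w := (contDiff_barrier α c R).of_le (by norm_cast)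
  have hdF : ∀ᶠ y in 𝓝 z, DifferentiableAt ℝ F y :=
    (hF2.eventually (by simp)).mono fun y hy => hy.differentiableAt (by simp)
  have hdw : Differentiable ℝ w := hw2.differentiable (by simp)
  have h1 : fderiv ℝ (F + ε • w) =ᶠ[𝓝 z] fderiv ℝ F + ε • fderiv ℝ w := by
    filter_upwards [hdF] with y hy
    rw [fderiv_add hy ((hdw y).const_smul ε), fderiv_const_smul (hdw y)]
    rfl
  have h2 : fderiv ℝ (fderiv ℝ (F + ε • w)) z =
      fderiv ℝ (fderiv ℝ F) z + ε • fderiv ℝ (fderiv ℝ w) z := by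
    have e1 : DifferentiableAt ℝ (fderiv ℝ F) z :=
      (hF2.fderiv_right (m := 1) (by norm_num)).differentiableAt (by simp)
    have e2 : DifferentiableAt ℝ (fderiv ℝ w) z :=
      (hw2.contDiffAt.fderiv_right (m := 1) (by norm_num)).differentiableAt (by simp)
    rw [h1.fderiv_eq, fderiv_add e1 (e2.const_smul ε), fderiv_const_smul e2]
  have h3 : fderiv ℝ F z + ε • fderiv ℝ w z = 0 := by
    rw [← hlm.fderiv_eq_zero]
    exact h1.eq_of_nhds.symm
  -- The decisive point: at `z` the derivative of `F` is `-ε` times that of `w`, which is nonzero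
  -- because `z ≠ c`. So the equation does hold at `z`.
  have hFz : fderiv ℝ F z ≠ 0 := by
    intro h0
    rw [h0, zero_add, smul_eq_zero] at h3
    have h4 := DFunLike.congr_fun (h3.resolve_left hε.ne') (z - c)
    rw [hwdef, fderiv_barrier] at h4
    simp only [smul_apply, innerSL_apply_apply, smul_eq_mul, zero_apply, mul_eq_zero,
      neg_eq_zero, OfNat.ofNat_ne_zero, hαpos.ne', Real.exp_ne_zero, false_or,
      inner_self_eq_zero] at h4
    exact hne z hz h4
  have hLF := (hL z hzΩ).resolve_left hFz
  have hneg := sum_mul_bilin_nonpos (hpos z hzΩ).posSemidef (fderiv ℝ (fderiv ℝ (F + ε • w)) z)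
    (fderiv_fderiv_apply_self_nonpos (hF2.add (hw2.contDiffAt.const_smul ε)) hlm)
    (fun i => EuclideanSpace.single i 1)
  -- The drift terms cancel at the critical point `z` of F + εw, leaving only the nonpositive second
  -- order part.
  have hsum : ellipticOp a b F z + ε * ellipticOp a b w z ≤ 0 := by
    have h5 := DFunLike.congr_fun h3 (b z)
    simp only [add_apply, smul_apply, smul_eq_mul, zero_apply] at h5
    simp only [h2, add_apply, smul_apply, smul_eq_mul, mul_add, Finset.sum_add_distrib,
      mul_left_comm _ ε, ← Finset.mul_sum] at hneg
    simp only [ellipticOp]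
    linarith
  have := mul_pos hε (hw z hz)
  linarith

/-- The strong maximum principle of Hopf, for functions that solve the equation away from their
critical points. -/
theorem eventuallyEq_const_of_max {Ω : Set 𝔼} (hΩ : IsOpen Ω) {F : 𝔼 → ℝ} (hF : ContDiffOn ℝ 2 F Ω)
    {a : 𝔼 → Matrix (Fin m) (Fin m) ℝ} (ha : ContinuousOn a Ω) (hpos : ∀ y ∈ Ω, (a y).PosDef)
    {b : 𝔼 → 𝔼} (hb : ContinuousOn b Ω)
    (hL : ∀ y ∈ Ω, fderiv ℝ F y = 0 ∨ ellipticOp a b F y = 0)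
    {y₀ : 𝔼} (hy₀ : y₀ ∈ Ω) (hmax : ∀ y ∈ Ω, F y ≤ F y₀) : ∀ᶠ y in 𝓝 y₀, F y = F y₀ := by
  obtain ⟨r, hr, hsub⟩ := Metric.isOpen_iff.1 hΩ y₀ hy₀
  -- With `q` within `r / 4` of `y₀`, every point at least as close to `q` as `y₀` is lies in the
  -- closed ball of radius `r / 2`, where the nearest maximum point is sought.
  refine Metric.eventually_nhds_iff_ball.2 ⟨r / 4, by positivity, fun q hq => ?_⟩
  by_contra hFq
  have hKsub : closedBall y₀ (r / 2) ⊆ Ω :=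
    (closedBall_subset_ball (by linarith)).trans hsub
  -- the nearest maximum point to `q`
  have hcl : IsClosed (closedBall y₀ (r / 2) ∩ F ⁻¹' {F y₀}) :=
    (hF.continuousOn.mono hKsub).preimage_isClosed_of_isClosed isClosed_closedBall
      isClosed_singleton
  have hcomp : IsCompact (closedBall y₀ (r / 2) ∩ F ⁻¹' {F y₀}) :=
    (isCompact_closedBall y₀ (r / 2)).of_isClosed_subset hcl inter_subset_left
  obtain ⟨p, ⟨hpb, hpF⟩, hpmin⟩ := hcomp.exists_isMinOn
    ⟨y₀, mem_closedBall_self (by positivity), rfl⟩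
    (continuous_id.dist (continuous_const (y := q))).continuousOn
  have hpF : F p = F y₀ := hpF
  have hpmin : ∀ y ∈ closedBall y₀ (r / 2), F y = F y₀ → dist p q ≤ dist y q :=
    fun y hy hy' => hpmin ⟨hy, hy'⟩
  have hpq : dist p q ≤ dist y₀ q := hpmin y₀ (mem_closedBall_self (by positivity)) rfl
  have hq4 : dist y₀ q < r / 4 := by rw [dist_comm]; exact hq
  have hne : p ≠ q := by
    rintro rfl
    exact hFq hpF
  -- The ball with diameter `pq` lies in the ball about `q` through `p` and meets its sphere only at
  -- `p`. As `p` is a nearest maximum point to `q`, no other maximum point lies in the smaller ball.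
  set c := midpoint ℝ p q with hc
  have hpc : dist p c = dist p q / 2 := by
    rw [hc, dist_left_midpoint, Real.norm_eq_abs, abs_of_pos two_pos]
    ring
  have hcq : dist c q = dist p q / 2 := by
    rw [hc, dist_midpoint_right, Real.norm_eq_abs, abs_of_pos two_pos]
    ring
  refine false_of_max_touches_ball hΩ hF ha hpos hb hL (c := c) (hKsub hpb) ?_ ?_ ?_
  · rw [← dist_pos, hpc]
    have := dist_pos.2 hne
    positivity
  · rw [hpF]
    exact hmax
  · intro y hy hyc hyp
    rw [hpF]
    refine lt_of_le_of_ne (hmax y hy) fun hyF => hyp ?_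
    rw [mem_closedBall, hpc] at hyc
    have h1 : dist y q ≤ dist p q := by linarith [dist_triangle y c q]
    have h2 : dist p q ≤ dist y q := by
      refine hpmin y ?_ hyF
      rw [mem_closedBall]
      linarith [dist_triangle y q y₀, dist_comm q y₀]
    have h3 : dist y q = dist p q := le_antisymm h1 h2
    have h4 : dist y c = dist p q / 2 := le_antisymm hyc (by linarith [dist_triangle y c q])
    -- Equality in the triangle inequality, with equal halves, makes `c` the midpoint of `y` and `q`
    -- by strict convexity.
    have hy_mid : c = midpoint ℝ y q := by
      apply eq_midpoint_of_dist_eq_half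
      · rw [h4, h3]
      · rw [hcq, h3]
    have := hc.symm.trans hy_mid
    simpa [midpoint_eq_smul_add] using this.symm

end StrongMaximumPrinciple

end RiemHarmonic

end

noncomputable section

namespace RiemHarmonic

open Set Filter Topology Metric
open scoped MatrixOrder

/-! ### Christoffel symbols of the first kind and the Hessian under coordinate changes -/

section Koszul

variable {E : Type*} [NormedAddCommGroup E] [NormedSpace ℝ E]

/-- The Christoffel symbol of the first kind of a field of bilinear forms on a vector space. -/
def koszul (G : E → E →L[ℝ] E →L[ℝ] ℝ) (y u v w : E) : ℝ :=
  1 / 2 * (fderiv ℝ G y u v w + fderiv ℝ G y v u w - fderiv ℝ G y w u v)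

/-- The covariant Hessian of `F` with respect to `G`, where `n` stands for the gradient of `F`
at `y`. -/
def hessForm (G : E → E →L[ℝ] E →L[ℝ] ℝ) (F : E → ℝ) (y n : E) : LinearMap.BilinForm ℝ E :=
  LinearMap.mk₂ ℝ (fun u v => fderiv ℝ (fderiv ℝ F) y u v - koszul G y u v n)
    (fun u u' v => by simp [koszul]; ring) (fun c u v => by simp [koszul]; ring)
    (fun u v v' => by simp [koszul]; ring) (fun c u v => by simp [koszul]; ring)

theorem hessForm_apply (G : E → E →L[ℝ] E →L[ℝ] ℝ) (F : E → ℝ) (y n u v : E) :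
    hessForm G F y n u v = fderiv ℝ (fderiv ℝ F) y u v - koszul G y u v n := rfl

theorem fderiv_bilin_apply {G : E → E →L[ℝ] E →L[ℝ] ℝ} {y : E}
    (hG : DifferentiableAt ℝ G y) {p q : E → E} {p' q' : E →L[ℝ] E}
    (hp : HasFDerivAt p p' y) (hq : HasFDerivAt q q' y) (w : E) :
    fderiv ℝ (fun z => G z (p z) (q z)) y w =
      fderiv ℝ G y w (p y) (q y) + G y (p' w) (q y) + G y (p y) (q' w) := by
  rw [((hG.hasFDerivAt.clm_apply hp).clm_apply hq).fderiv]
  simp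
  ring

theorem fderiv_apply_apply {G : E → E →L[ℝ] E →L[ℝ] ℝ} {y : E}
    (hG : DifferentiableAt ℝ G y) (u v w : E) :
    fderiv ℝ (fun z => G z u v) y w = fderiv ℝ G y w u v := by
  rw [fderiv_bilin_apply hG (hasFDerivAt_const u y) (hasFDerivAt_const v y)]
  simp

variable {G G' : E → E →L[ℝ] E →L[ℝ] ℝ} {ψ : E → E} {z : E}

theorem fderiv_pullback (hψ : ContDiffAt ℝ 2 ψ z) (hG : DifferentiableAt ℝ G (ψ z))
    (hG'd : DifferentiableAt ℝ G' z)
    (hG' : ∀ᶠ y in 𝓝 z, ∀ u v, G' y u v = G (ψ y) (fderiv ℝ ψ y u) (fderiv ℝ ψ y v)) (u v w : E) :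
    fderiv ℝ G' z w u v =
      fderiv ℝ G (ψ z) (fderiv ℝ ψ z w) (fderiv ℝ ψ z u) (fderiv ℝ ψ z v) +
      G (ψ z) (fderiv ℝ (fderiv ℝ ψ) z w u) (fderiv ℝ ψ z v) +
      G (ψ z) (fderiv ℝ ψ z u) (fderiv ℝ (fderiv ℝ ψ) z w v) := by
  have hψ1 : HasFDerivAt ψ (fderiv ℝ ψ z) z := (hψ.differentiableAt (by simp)).hasFDerivAt
  have hψ2 : HasFDerivAt (fderiv ℝ ψ) (fderiv ℝ (fderiv ℝ ψ) z) z :=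
    ((hψ.fderiv_right (m := 1) (by norm_num)).differentiableAt (by simp)).hasFDerivAt
  rw [← fderiv_apply_apply hG'd]
  have h1 : (fun y => G' y u v) =ᶠ[𝓝 z] fun y => G (ψ y) (fderiv ℝ ψ y u) (fderiv ℝ ψ y v) :=
    hG'.mono fun y hy => hy u v
  have hcomp : HasFDerivAt (fun y => G (ψ y)) ((fderiv ℝ G (ψ z)).comp (fderiv ℝ ψ z)) z :=
    HasFDerivAt.comp z (g := G) hG.hasFDerivAt hψ1
  rw [h1.fderiv_eq, fderiv_bilin_apply (G := fun y => G (ψ y)) hcomp.differentiableAt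
    (hψ2.clm_apply (hasFDerivAt_const u z)) (hψ2.clm_apply (hasFDerivAt_const v z)), hcomp.fderiv]
  simp

/-- Differentiating the pullback produces six terms with second derivatives of `ψ`. By symmetry four
of them cancel and the two containing D²ψ(u, v) add up. -/
theorem koszul_pullback (hψ : ContDiffAt ℝ 2 ψ z) (hG : DifferentiableAt ℝ G (ψ z))
    (hsymm : ∀ u v, G (ψ z) u v = G (ψ z) v u) (hG'd : DifferentiableAt ℝ G' z)
    (hG' : ∀ᶠ y in 𝓝 z, ∀ u v, G' y u v = G (ψ y) (fderiv ℝ ψ y u) (fderiv ℝ ψ y v)) (u v w : E) :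
    koszul G' z u v w = koszul G (ψ z) (fderiv ℝ ψ z u) (fderiv ℝ ψ z v) (fderiv ℝ ψ z w) +
      G (ψ z) (fderiv ℝ ψ z w) (fderiv ℝ (fderiv ℝ ψ) z u v) := by
  have hs : ∀ u v, fderiv ℝ (fderiv ℝ ψ) z u v = fderiv ℝ (fderiv ℝ ψ) z v u :=
    hψ.isSymmSndFDerivAt (by simp)
  simp only [koszul, fderiv_pullback hψ hG hG'd hG']
  rw [hs v u, hs w u, hs w v, hsymm (fderiv ℝ (fderiv ℝ ψ) z u v),
    hsymm (fderiv ℝ (fderiv ℝ ψ) z u w)]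
  ring

/-- The inhomogeneous term DF(D²ψ(u, v)) is what cancels the one in `koszul_pullback` when the third
argument is the gradient of `F`. -/
theorem fderiv_fderiv_comp {F F' : E → ℝ} (hψ : ContDiffAt ℝ 2 ψ z) (hF : ContDiffAt ℝ 2 F (ψ z))
    (hF' : F' =ᶠ[𝓝 z] F ∘ ψ) (u v : E) :
    fderiv ℝ (fderiv ℝ F') z u v =
      fderiv ℝ (fderiv ℝ F) (ψ z) (fderiv ℝ ψ z u) (fderiv ℝ ψ z v) +
        fderiv ℝ F (ψ z) (fderiv ℝ (fderiv ℝ ψ) z u v) := by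
  have hψ1 : HasFDerivAt ψ (fderiv ℝ ψ z) z := (hψ.differentiableAt (by simp)).hasFDerivAt
  have hψ2 : HasFDerivAt (fderiv ℝ ψ) (fderiv ℝ (fderiv ℝ ψ) z) z :=
    ((hψ.fderiv_right (m := 1) (by norm_num)).differentiableAt (by simp)).hasFDerivAt
  have hF2 : HasFDerivAt (fderiv ℝ F) (fderiv ℝ (fderiv ℝ F) (ψ z)) (ψ z) :=
    ((hF.fderiv_right (m := 1) (by norm_num)).differentiableAt (by simp)).hasFDerivAt
  have h1 : fderiv ℝ F' =ᶠ[𝓝 z] fun y => (fderiv ℝ F (ψ y)).comp (fderiv ℝ ψ y) := by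
    have e1 : ∀ᶠ y in 𝓝 z, DifferentiableAt ℝ F (ψ y) :=
      hψ1.continuousAt.eventually
        ((hF.eventually (by simp)).mono fun y hy => hy.differentiableAt (by simp))
    have e2 : ∀ᶠ y in 𝓝 z, DifferentiableAt ℝ ψ y :=
      (hψ.eventually (by simp)).mono fun y hy => hy.differentiableAt (by simp)
    filter_upwards [hF'.fderiv (𝕜 := ℝ), e1, e2] with y hy h1 h2
    rw [hy]
    exact fderiv_comp y h1 h2
  have h2 : HasFDerivAt (fun y => fderiv ℝ F (ψ y))
      ((fderiv ℝ (fderiv ℝ F) (ψ z)).comp (fderiv ℝ ψ z)) z :=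
    HasFDerivAt.comp z (g := fderiv ℝ F) hF2 hψ1
  rw [h1.fderiv_eq, (h2.clm_comp hψ2).fderiv]
  simp
  ring

/-- The covariant Hessian is invariant under a change of coordinates. -/
theorem hessForm_pullback {F F' : E → ℝ} (hψ : ContDiffAt ℝ 2 ψ z)
    (hG : DifferentiableAt ℝ G (ψ z)) (hsymm : ∀ u v, G (ψ z) u v = G (ψ z) v u)
    (hG'd : DifferentiableAt ℝ G' z)
    (hG' : ∀ᶠ y in 𝓝 z, ∀ u v, G' y u v = G (ψ y) (fderiv ℝ ψ y u) (fderiv ℝ ψ y v))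
    (hF : ContDiffAt ℝ 2 F (ψ z)) (hF' : F' =ᶠ[𝓝 z] F ∘ ψ) {n : E}
    (hn : ∀ w, G (ψ z) (fderiv ℝ ψ z n) w = fderiv ℝ F (ψ z) w) (u v : E) :
    hessForm G' F' z n u v =
      hessForm G F (ψ z) (fderiv ℝ ψ z n) (fderiv ℝ ψ z u) (fderiv ℝ ψ z v) := by
  rw [hessForm_apply, hessForm_apply, koszul_pullback hψ hG hsymm hG'd hG',
    fderiv_fderiv_comp hψ hF hF', hn]
  ring

/-- The Christoffel symbols of the first kind of `G - dF ⊗ dF`. -/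
theorem koszul_sub_mul {F : E → ℝ} (hF : ContDiffAt ℝ 2 F z) (hG : DifferentiableAt ℝ G z)
    (hG'd : DifferentiableAt ℝ G' z)
    (hG' : ∀ᶠ y in 𝓝 z, ∀ u v, G' y u v = G y u v - fderiv ℝ F y u * fderiv ℝ F y v) (u v w : E) :
    koszul G' z u v w =
      koszul G z u v w - fderiv ℝ (fderiv ℝ F) z u v * fderiv ℝ F z w := by
  have hF2 : HasFDerivAt (fderiv ℝ F) (fderiv ℝ (fderiv ℝ F) z) z :=
    ((hF.fderiv_right (m := 1) (by norm_num)).differentiableAt (by simp)).hasFDerivAt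
  have hs : ∀ u v, fderiv ℝ (fderiv ℝ F) z u v = fderiv ℝ (fderiv ℝ F) z v u :=
    hF.isSymmSndFDerivAt (by simp)
  have key : ∀ u v w, fderiv ℝ G' z w u v = fderiv ℝ G z w u v -
      (fderiv ℝ (fderiv ℝ F) z w u * fderiv ℝ F z v +
        fderiv ℝ F z u * fderiv ℝ (fderiv ℝ F) z w v) := by
    intro u v w
    have h1 : (fun y => G' y u v) =ᶠ[𝓝 z]
        (fun y => G y u v) - (fun y => fderiv ℝ F y u) * fun y => fderiv ℝ F y v :=
      hG'.mono fun y hy => hy u v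
    have h2 : HasFDerivAt (fun y => G y u v) (fderiv ℝ (fun y => G y u v) z) z := by
      have := (hG.hasFDerivAt.clm_apply (hasFDerivAt_const u z)).clm_apply (hasFDerivAt_const v z)
      exact this.differentiableAt.hasFDerivAt
    have h3 : ∀ u, HasFDerivAt (fun y => fderiv ℝ F y u) ((fderiv ℝ (fderiv ℝ F) z).flip u) z := by
      intro u
      refine (hF2.clm_apply (hasFDerivAt_const u z)).congr_fderiv ?_
      ext; simp
    rw [← fderiv_apply_apply hG'd, h1.fderiv_eq, (h2.sub ((h3 u).mul (h3 v))).fderiv,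
      ← fderiv_apply_apply hG]
    simp
    ring
  simp only [koszul, key]
  -- By symmetry of D²F, four of the six product terms cancel and the remaining two coincide.
  rw [hs v u, hs w u, hs w v]
  ring

end Koszul

/-! ### Matrix algebra: traces under congruence and rank one perturbations -/

section MatrixTrace

open Matrix

variable {ι : Type*} [Fintype ι]

theorem sum_mul_eq_trace (A H : Matrix ι ι ℝ) : ∑ i, ∑ j, A i j * H i j = (A * Hᵀ).trace := by
  simp [trace, mul_apply]

variable [DecidableEq ι]

/-- The contraction is a trace, in which the factors of `J` cancel by cyclicity. This is the
independence of the basis of the trace of one form against another. -/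
theorem sum_inv_mul_congr (A H J : Matrix ι ι ℝ) (hJ : IsUnit J.det) :
    ∑ i, ∑ j, (Jᵀ * A * J)⁻¹ i j * (Jᵀ * H * J) i j = ∑ i, ∑ j, A⁻¹ i j * H i j := by
  have hJt : IsUnit Jᵀ.det := by rwa [det_transpose]
  rw [sum_mul_eq_trace, sum_mul_eq_trace, Matrix.mul_inv_rev, Matrix.mul_inv_rev, transpose_mul, transpose_mul,
    transpose_transpose]
  have : J⁻¹ * (A⁻¹ * Jᵀ⁻¹) * (Jᵀ * (Hᵀ * J)) = J⁻¹ * (A⁻¹ * (Jᵀ⁻¹ * Jᵀ) * Hᵀ * J) := by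
    simp only [Matrix.mul_assoc]
  rw [this, nonsing_inv_mul _ hJt, Matrix.mul_one, trace_mul_comm, Matrix.mul_assoc,
    mul_nonsing_inv _ hJ, Matrix.mul_one]

/-- The difference of the Christoffel symbols of the second kind of `A` and of `A - d ⊗ d`, given
those of the first kind. -/
theorem inv_mulVec_sub_inv_mulVec {A B : Matrix ι ι ℝ} (hA : IsUnit A.det) (hB : IsUnit B.det)
    {d : ι → ℝ} (hAB : ∀ i j, B i j = A i j - d i * d j) (k : ι → ℝ) (q : ℝ) :
    A⁻¹ *ᵥ k - B⁻¹ *ᵥ (k - q • d) = (q - d ⬝ᵥ A⁻¹ *ᵥ k) • B⁻¹ *ᵥ d := by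
  have hB' : B = A - vecMulVec d d := by
    ext i j
    simp [hAB, vecMulVec_apply]
  -- Applying `B` instead of computing its inverse avoids the Sherman–Morrison formula.
  have h1 : B *ᵥ (A⁻¹ *ᵥ k) = k - (d ⬝ᵥ A⁻¹ *ᵥ k) • d := by
    rw [hB', sub_mulVec, mulVec_mulVec, mul_nonsing_inv _ hA, one_mulVec, vecMulVec_mulVec]
    ext i
    simp [mul_comm]
  have h2 : A⁻¹ *ᵥ k = B⁻¹ *ᵥ (k - (d ⬝ᵥ A⁻¹ *ᵥ k) • d) := by
    rw [← h1, mulVec_mulVec, nonsing_inv_mul _ hB, one_mulVec]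
  rw [h2, ← mulVec_sub, ← mulVec_smul]
  congr 1
  rw [← h2]
  module

end MatrixTrace

end RiemHarmonic

end

noncomputable section

namespace RiemHarmonic

open Set Filter Topology
open scoped MatrixOrder

/-! ### Metrics and functions read in charts -/

section Chart

variable {m : ℕ} {M : Type*} [TopologicalSpace M] [ChartedSpace (EuclideanSpace ℝ (Fin m)) M]

local notation "𝔼" => EuclideanSpace ℝ (Fin m)

/-- The transition map from the preferred chart at `x` to that at `p`. -/
def transition (x p : M) (z : 𝔼) : 𝔼 := extChartAt (𝓡 m) p ((extChartAt (𝓡 m) x).symm z)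

theorem extChartAt_symm_transition {x p : M} {z : 𝔼}
    (hp : (extChartAt (𝓡 m) x).symm z ∈ (extChartAt (𝓡 m) p).source) :
    (extChartAt (𝓡 m) p).symm (transition x p z) = (extChartAt (𝓡 m) x).symm z :=
  (extChartAt (𝓡 m) p).left_inv hp

variable [IsManifold (𝓡 m) ∞ M]

/-- The derivative of the inverse of the preferred chart at `p`, as an endomorphism of the model
space. -/
def chartSymmDeriv (p : M) (y : 𝔼) : 𝔼 →L[ℝ] 𝔼 :=
  mfderiv (𝓡 m) (𝓡 m) (extChartAt (𝓡 m) p).symm y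

/-- A metric in the preferred chart at `p`, as a field of bilinear forms on the model space. -/
def chartForm (g : Metric m M) (p : M) (y : 𝔼) : 𝔼 →L[ℝ] 𝔼 →L[ℝ] ℝ :=
  ContinuousLinearMap.bilinearComp (E := 𝔼) (F := 𝔼) (g.inner ((extChartAt (𝓡 m) p).symm y))
    (chartSymmDeriv p y) (chartSymmDeriv p y)

theorem chartForm_apply (g : Metric m M) (p : M) (y u v : 𝔼) :
    chartForm g p y u v = g.inner ((extChartAt (𝓡 m) p).symm y)
      (chartSymmDeriv p y u) (chartSymmDeriv p y v) := rfl

theorem gram_apply (g : Metric m M) (p : M) (y : 𝔼) (i j : Fin m) :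
    gram g p y i j =
      chartForm g p y (EuclideanSpace.single i 1) (EuclideanSpace.single j 1) := rfl

theorem chartForm_symm (g : Metric m M) (p : M) (y u v : 𝔼) :
    chartForm g p y u v = chartForm g p y v u := g.symm _ _ _

theorem contMDiffAt_extChartAt_symm {p : M} {y : 𝔼} (hy : y ∈ (extChartAt (𝓡 m) p).target) :
    ContMDiffAt (𝓡 m) (𝓡 m) ∞ (extChartAt (𝓡 m) p).symm y :=
  (contMDiffOn_extChartAt_symm p).contMDiffAt ((isOpen_extChartAt_target p).mem_nhds hy)

theorem hasMFDerivAt_extChartAt_symm {p : M} {y : 𝔼} (hy : y ∈ (extChartAt (𝓡 m) p).target) :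
    HasMFDerivAt (𝓡 m) (𝓡 m) (extChartAt (𝓡 m) p).symm y (chartSymmDeriv p y) :=
  ((contMDiffAt_extChartAt_symm hy).mdifferentiableAt (by simp)).hasMFDerivAt

theorem chartSymmDeriv_injective {p : M} {y : 𝔼} (hy : y ∈ (extChartAt (𝓡 m) p).target) :
    Function.Injective (chartSymmDeriv p y) := by
  have : IsManifold (𝓡 m) 1 M := IsManifold.of_le (n := ∞) (by simp)
  have h := (isInvertible_mfderivWithin_extChartAt_symm (I := 𝓡 m) hy).injective
  rw [ModelWithCorners.range_eq_univ, mfderivWithin_univ] at h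
  exact h

theorem chartForm_self_pos (g : Metric m M) {p : M} {y : 𝔼} (hy : y ∈ (extChartAt (𝓡 m) p).target)
    {u : 𝔼} (hu : u ≠ 0) : 0 < chartForm g p y u u := by
  refine g.pos _ _ fun h => hu (chartSymmDeriv_injective hy ?_)
  rw [map_zero]
  exact h

/-- It suffices to test on constant vectors. Their images under the derivative of the inverse chart
are smooth sections along that map, and the smooth bundle metric is evaluated on them. -/
theorem contDiffOn_chartForm (g : Metric m M) (p : M) :
    ContDiffOn ℝ ∞ (chartForm g p) (extChartAt (𝓡 m) p).target := by
  refine contDiffOn_clm_apply.2 fun u => contDiffOn_clm_apply.2 fun v => ?_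
  intro y hy
  refine ContDiffAt.contDiffWithinAt ?_
  rw [← contMDiffAt_iff_contDiffAt]
  have hb := contMDiffAt_extChartAt_symm hy
  have hvec : ∀ u : 𝔼, ContMDiffAt (𝓡 m) (𝓡 m).tangent ∞
      (fun z => Bundle.TotalSpace.mk' 𝔼 (E := fun x : M => TangentSpace (𝓡 m) x)
        ((extChartAt (𝓡 m) p).symm z) (chartSymmDeriv p z u)) y := by
    intro u
    let V : ∀ z : 𝔼, TangentSpace (𝓡 m) z := fun _ => u
    have hV : ContMDiffAt (𝓡 m) (𝓡 m).tangent ∞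
        (fun z : 𝔼 => (V z : TangentBundle (𝓡 m) 𝔼)) y :=
      contMDiffAt_vectorSpace_iff_contDiffAt.2 contDiffAt_const
    let ϕ : ∀ z : 𝔼, TangentSpace (𝓡 m) z →L[ℝ]
        TangentSpace (𝓡 m) ((extChartAt (𝓡 m) p).symm z) :=
      fun z => mfderiv (𝓡 m) (𝓡 m) (extChartAt (𝓡 m) p).symm z
    have hϕ : ContMDiffAt (𝓡 m) 𝓘(ℝ, 𝔼 →L[ℝ] 𝔼) ∞
        (fun z => ContinuousLinearMap.inCoordinates 𝔼 (TangentSpace (𝓡 m) (M := 𝔼)) 𝔼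
          (TangentSpace (𝓡 m) (M := M)) y z ((extChartAt (𝓡 m) p).symm y)
          ((extChartAt (𝓡 m) p).symm z) (ϕ z)) y :=
      hb.mfderiv_const (m := ∞) (by simp)
    exact ContMDiffAt.clm_apply_of_inCoordinates (b₁ := fun z : 𝔼 => z)
      (b₂ := (extChartAt (𝓡 m) p).symm) (F₁ := 𝔼) (F₂ := 𝔼) (E₁ := TangentSpace (𝓡 m) (M := 𝔼))
      (E₂ := TangentSpace (𝓡 m) (M := M)) (ϕ := ϕ) (v := V) hϕ hV hb
  have : ContMDiffAt (𝓡 m) ((𝓡 m).prod 𝓘(ℝ)) ∞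
      (fun z => Bundle.TotalSpace.mk' ℝ (E := Bundle.Trivial M ℝ) ((extChartAt (𝓡 m) p).symm z)
        (g.inner ((extChartAt (𝓡 m) p).symm z) (chartSymmDeriv p z u) (chartSymmDeriv p z v))) y := by
    apply ContMDiffAt.clm_bundle_apply₂ (F₁ := 𝔼) (F₂ := 𝔼)
    · exact ContMDiffAt.comp y g.contMDiff.contMDiffAt hb
    · exact hvec u
    · exact hvec v
  simp only [Bundle.contMDiffAt_totalSpace] at this
  exact this.2

theorem differentiableAt_chartForm (g : Metric m M) {p : M} {y : 𝔼}
    (hy : y ∈ (extChartAt (𝓡 m) p).target) : DifferentiableAt ℝ (chartForm g p) y :=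
  ((contDiffOn_chartForm g p).contDiffAt
    ((isOpen_extChartAt_target p).mem_nhds hy)).differentiableAt (by simp)

theorem posDef_gram (g : Metric m M) {p : M} {y : 𝔼} (hy : y ∈ (extChartAt (𝓡 m) p).target) :
    (gram g p y).PosDef := by
  refine Matrix.PosDef.of_dotProduct_mulVec_pos ?_ fun u hu => ?_
  · ext i j
    simp only [Matrix.conjTranspose_apply, star_trivial, gram_apply]
    exact chartForm_symm g p y _ _
  · set U : 𝔼 := WithLp.toLp 2 u with hU
    have hpos := chartForm_self_pos g hy (u := U) (by simpa [hU] using hu)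
    have hexp : U = ∑ i, u i • (EuclideanSpace.single i 1 : 𝔼) := by
      ext k
      simp [hU, Pi.single_apply]
    rw [hexp] at hpos
    simp only [map_sum, map_smul, sum_apply, smul_apply, smul_eq_mul] at hpos
    refine hpos.trans_eq ?_
    simp only [dotProduct, Matrix.mulVec, Finset.mul_sum, star_trivial, gram_apply]
    rw [Finset.sum_comm]
    refine Finset.sum_congr rfl fun i _ => Finset.sum_congr rfl fun j _ => ?_
    ring

theorem isUnit_det_gram (g : Metric m M) {p : M} {y : 𝔼}
    (hy : y ∈ (extChartAt (𝓡 m) p).target) : IsUnit (gram g p y).det :=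
  (posDef_gram g hy).det_pos.ne'.isUnit

theorem contDiffOn_comp_extChartAt_symm {f : M → ℝ} (hf : ContMDiff (𝓡 m) 𝓘(ℝ, ℝ) ∞ f) (p : M) :
    ContDiffOn ℝ ∞ (f ∘ (extChartAt (𝓡 m) p).symm) (extChartAt (𝓡 m) p).target := by
  rw [← contMDiffOn_iff_contDiffOn]
  exact hf.comp_contMDiffOn (contMDiffOn_extChartAt_symm p)

theorem fderiv_comp_extChartAt_symm {f : M → ℝ} (hf : ContMDiff (𝓡 m) 𝓘(ℝ, ℝ) ∞ f) {p : M} {y : 𝔼}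
    (hy : y ∈ (extChartAt (𝓡 m) p).target) (u : 𝔼) :
    fderiv ℝ (f ∘ (extChartAt (𝓡 m) p).symm) y u =
      mvfderiv (𝓡 m) f ((extChartAt (𝓡 m) p).symm y) (chartSymmDeriv p y u) := by
  let A : 𝔼 →L[ℝ] ℝ := mvfderiv (𝓡 m) f ((extChartAt (𝓡 m) p).symm y)
  have h1 := (hf.mdifferentiable (by simp) ((extChartAt (𝓡 m) p).symm y)).hasMFDerivAt
  have h2 : HasFDerivAt (f ∘ (extChartAt (𝓡 m) p).symm) (A.comp (chartSymmDeriv p y)) y :=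
    (h1.comp y (hasMFDerivAt_extChartAt_symm hy)).hasFDerivAt
  rw [h2.fderiv]
  rfl

theorem chartForm_deform (g : Metric m M) (f : M → ℝ) (hf : ContMDiff (𝓡 m) 𝓘(ℝ, ℝ) ∞ f)
    (hlt : ∀ x, g.inner x (grad g f x) (grad g f x) < 1) {p : M} {y : 𝔼}
    (hy : y ∈ (extChartAt (𝓡 m) p).target) (u v : 𝔼) :
    chartForm (deform g f hf hlt) p y u v = chartForm g p y u v -
      fderiv ℝ (f ∘ (extChartAt (𝓡 m) p).symm) y u *
        fderiv ℝ (f ∘ (extChartAt (𝓡 m) p).symm) y v := by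
  rw [fderiv_comp_extChartAt_symm hf hy, fderiv_comp_extChartAt_symm hf hy]
  rfl

theorem contDiffAt_transition {x p : M} {z : 𝔼} (hz : z ∈ (extChartAt (𝓡 m) x).target)
    (hp : (extChartAt (𝓡 m) x).symm z ∈ (extChartAt (𝓡 m) p).source) :
    ContDiffAt ℝ ∞ (transition x p) z := by
  rw [← contMDiffAt_iff_contDiffAt]
  refine ContMDiffAt.comp z ?_ (contMDiffAt_extChartAt_symm hz)
  exact contMDiffAt_extChartAt' (by simpa using hp)

theorem eventually_mem_source {x p : M} {z : 𝔼} (hz : z ∈ (extChartAt (𝓡 m) x).target)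
    (hp : (extChartAt (𝓡 m) x).symm z ∈ (extChartAt (𝓡 m) p).source) :
    ∀ᶠ y in 𝓝 z, y ∈ (extChartAt (𝓡 m) x).target ∧
      (extChartAt (𝓡 m) x).symm y ∈ (extChartAt (𝓡 m) p).source :=
  ((isOpen_extChartAt_target x).eventually_mem hz).and
    ((contMDiffAt_extChartAt_symm hz).continuousAt.eventually
      ((isOpen_extChartAt_source p).mem_nhds hp))

/-- Near `z` the inverse chart at `x` is the inverse chart at `p` after the transition map; the
chain rule gives the pullback formula. -/
theorem chartForm_transition (g : Metric m M) {x p : M} {z : 𝔼}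
    (hz : z ∈ (extChartAt (𝓡 m) x).target)
    (hp : (extChartAt (𝓡 m) x).symm z ∈ (extChartAt (𝓡 m) p).source) (u v : 𝔼) :
    chartForm g x z u v = chartForm g p (transition x p z) (fderiv ℝ (transition x p) z u)
      (fderiv ℝ (transition x p) z v) := by
  have hψ : HasMFDerivAt (𝓡 m) (𝓡 m) (transition x p) z (fderiv ℝ (transition x p) z) :=
    ((contDiffAt_transition hz hp).differentiableAt (by simp)).hasFDerivAt.hasMFDerivAt
  have hy : transition x p z ∈ (extChartAt (𝓡 m) p).target := (extChartAt (𝓡 m) p).map_source hp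
  have h1 := (hasMFDerivAt_extChartAt_symm hy).comp z hψ
  have h2 : (extChartAt (𝓡 m) x).symm =ᶠ[𝓝 z] (extChartAt (𝓡 m) p).symm ∘ transition x p :=
    (eventually_mem_source hz hp).mono fun y hy => (extChartAt_symm_transition hy.2).symm
  have h3 := hasMFDerivAt_unique (hasMFDerivAt_extChartAt_symm hz) (h1.congr_of_eventuallyEq h2)
  have h4 : chartSymmDeriv x z =
    (chartSymmDeriv p (transition x p z)).comp (fderiv ℝ (transition x p) z) := h3
  -- The two base points are only propositionally equal; all tangent spaces are the model space, so
  -- the vectors can stay fixed while the base point is replaced.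
  have aux : ∀ {q q' : M}, q = q' → ∀ u v : 𝔼, g.inner q u v = g.inner q' u v := by
    rintro q _ rfl u v
    rfl
  rw [chartForm_apply, chartForm_apply, h4]
  exact aux (extChartAt_symm_transition hp).symm _ _

end Chart

end RiemHarmonic

end

noncomputable section

namespace RiemHarmonic

open Set Filter Topology Matrix
open scoped MatrixOrder

/-! ### The tension field of the identity map -/

section Tension

variable {m : ℕ} {M : Type*} [TopologicalSpace M] [ChartedSpace (EuclideanSpace ℝ (Fin m)) M]
  [IsManifold (𝓡 m) ∞ M]

local notation "𝔼" => EuclideanSpace ℝ (Fin m)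

theorem sum_smul_single (u : 𝔼) : ∑ i, u i • (EuclideanSpace.single i 1 : 𝔼) = u := by
  ext k
  simp [Pi.single_apply]

theorem bilin_single_eq (H : LinearMap.BilinForm ℝ 𝔼) (u v : 𝔼) :
    H u v = ∑ i, ∑ j, u i * H (EuclideanSpace.single i 1) (EuclideanSpace.single j 1) * v j := by
  conv_lhs => rw [← sum_smul_single u, ← sum_smul_single v]
  simp only [map_sum, map_smul, LinearMap.sum_apply, LinearMap.smul_apply, smul_eq_mul]
  simp only [Finset.mul_sum]
  rw [Finset.sum_comm]
  refine Finset.sum_congr rfl fun i _ => Finset.sum_congr rfl fun j _ => ?_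
  ring

/-- The matrix of a bilinear form in the standard basis. -/
def formMatrix (H : LinearMap.BilinForm ℝ 𝔼) : Matrix (Fin m) (Fin m) ℝ :=
  Matrix.of fun i j => H (EuclideanSpace.single i 1) (EuclideanSpace.single j 1)

/-- The matrix of an endomorphism in the standard basis. -/
def endMatrix (L : 𝔼 →L[ℝ] 𝔼) : Matrix (Fin m) (Fin m) ℝ :=
  Matrix.of fun k i => L (EuclideanSpace.single i 1) k

theorem formMatrix_pullback {H H' : LinearMap.BilinForm ℝ 𝔼} {L : 𝔼 →L[ℝ] 𝔼}
    (h : ∀ u v, H' u v = H (L u) (L v)) :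
    formMatrix H' = (endMatrix L)ᵀ * formMatrix H * endMatrix L := by
  ext i j
  simp only [formMatrix, endMatrix, Matrix.of_apply, h, mul_apply, transpose_apply, Finset.sum_mul]
  rw [bilin_single_eq H, Finset.sum_comm]

/-- A metric in the preferred chart at `p`, as an algebraic bilinear form. -/
def chartBilin (g : Metric m M) (p : M) (y : 𝔼) : LinearMap.BilinForm ℝ 𝔼 :=
  LinearMap.mk₂ ℝ (fun v w => chartForm g p y v w) (by simp) (by simp) (by simp) (by simp)

theorem formMatrix_chartBilin (g : Metric m M) (p : M) (y : 𝔼) :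
    formMatrix (chartBilin g p y) = gram g p y := rfl

theorem exists_chartForm_eq (g : Metric m M) {p : M} {y : 𝔼}
    (hy : y ∈ (extChartAt (𝓡 m) p).target) (L : 𝔼 →L[ℝ] ℝ) :
    ∃ n, ∀ w, chartForm g p y n w = L w := by
  have hnd : (chartBilin g p y).Nondegenerate := by
    refine ⟨fun v hv => ?_, fun v hv => ?_⟩ <;>
    · by_contra h
      exact (chartForm_self_pos g hy h).ne' (hv v)
  exact ⟨_, LinearMap.BilinForm.apply_toDual_symm_apply (hB := hnd) L.toLinearMap⟩

theorem christoffel_eq (g : Metric m M) {p : M} {y : 𝔼} (hy : y ∈ (extChartAt (𝓡 m) p).target)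
    (k i j : Fin m) :
    christoffel g p k i j y = ((gram g p y)⁻¹ *ᵥ fun l => koszul (chartForm g p) y
      (EuclideanSpace.single i 1) (EuclideanSpace.single j 1) (EuclideanSpace.single l 1)) k := by
  have h : ∀ i j l : Fin m, pderiv i (fun z => gram g p z j l) y =
      fderiv ℝ (chartForm g p) y (EuclideanSpace.single i 1) (EuclideanSpace.single j 1)
        (EuclideanSpace.single l 1) := fun i j l =>
    fderiv_apply_apply (differentiableAt_chartForm g hy) _ _ _
  simp only [christoffel, h, mulVec, dotProduct, koszul, Finset.mul_sum]
  refine Finset.sum_congr rfl fun l _ => ?_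
  ring

/-- Writing `L` as the Gram matrix applied to `n` cancels the inverse Gram matrix in the symbols of
the second kind. This replaces index sums by the basis-free `koszul`. -/
theorem sum_christoffel_mul (g : Metric m M) {p : M} {y : 𝔼}
    (hy : y ∈ (extChartAt (𝓡 m) p).target) {L : 𝔼 →L[ℝ] ℝ} {n : 𝔼}
    (hn : ∀ w, chartForm g p y n w = L w) (i j : Fin m) :
    ∑ k, christoffel g p k i j y * L (EuclideanSpace.single k 1) =
      koszul (chartForm g p) y (EuclideanSpace.single i 1) (EuclideanSpace.single j 1) n := by
  set κ : Fin m → ℝ := fun l => koszul (chartForm g p) y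
      (EuclideanSpace.single i 1) (EuclideanSpace.single j 1) (EuclideanSpace.single l 1) with hκ
  have h1 : ∀ k, L (EuclideanSpace.single k 1) = (n.ofLp ᵥ* gram g p y) k := by
    intro k
    rw [← hn]
    conv_lhs => rw [← sum_smul_single n]
    simp only [map_sum, map_smul, _root_.sum_apply, _root_.smul_apply, smul_eq_mul, vecMul, dotProduct,
      gram_apply]
  have h2 : ∑ k, christoffel g p k i j y * L (EuclideanSpace.single k 1) =
      (n.ofLp ᵥ* gram g p y) ⬝ᵥ ((gram g p y)⁻¹ *ᵥ κ) := by
    simp only [dotProduct, christoffel_eq g hy, h1, hκ]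
    exact Finset.sum_congr rfl fun k _ => mul_comm _ _
  rw [h2, ← dotProduct_mulVec, mulVec_mulVec, mul_nonsing_inv _ (isUnit_det_gram g hy),
    one_mulVec]
  conv_rhs => rw [← sum_smul_single n]
  simp only [dotProduct, hκ, koszul, map_sum, map_smul, _root_.sum_apply, _root_.smul_apply, smul_eq_mul,
    ← Finset.sum_add_distrib, ← Finset.sum_sub_distrib]
  rw [Finset.mul_sum]
  refine Finset.sum_congr rfl fun l _ => ?_
  ring

/-- The component `∂ᵢ∂ⱼf - Γᵏᵢⱼ ∂ₖf` of the Hessian of `f` in the preferred chart at `p`. -/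
def coordHess (g : Metric m M) (f : M → ℝ) (p : M) (y : 𝔼) (i j : Fin m) : ℝ :=
  fderiv ℝ (fderiv ℝ (f ∘ (extChartAt (𝓡 m) p).symm)) y (EuclideanSpace.single i 1)
      (EuclideanSpace.single j 1)
    - ∑ k, christoffel g p k i j y *
      fderiv ℝ (f ∘ (extChartAt (𝓡 m) p).symm) y (EuclideanSpace.single k 1)

theorem coordHess_eq_formMatrix (g : Metric m M) (f : M → ℝ) {p : M} {y : 𝔼}
    (hy : y ∈ (extChartAt (𝓡 m) p).target) {n : 𝔼}
    (hn : ∀ w, chartForm g p y n w = fderiv ℝ (f ∘ (extChartAt (𝓡 m) p).symm) y w) (i j : Fin m) :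
    coordHess g f p y i j =
      formMatrix (hessForm (chartForm g p) (f ∘ (extChartAt (𝓡 m) p).symm) y n) i j := by
  rw [coordHess, sum_christoffel_mul g hy hn]
  rfl

/-- The trace with respect to `h` of the Hessian of `f` with respect to `g`, in the preferred chart
at `p`. -/
def traceHess (h g : Metric m M) (f : M → ℝ) (p : M) (y : 𝔼) : ℝ :=
  ∑ i, ∑ j, (gram h p y)⁻¹ i j * coordHess g f p y i j

/-- A kernel vector would have zero length for the pulled back metric, so the derivative is
injective, and the dimension is finite. -/
theorem fderiv_transition_surjective (g : Metric m M) {x p : M} {z : 𝔼}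
    (hz : z ∈ (extChartAt (𝓡 m) x).target)
    (hp : (extChartAt (𝓡 m) x).symm z ∈ (extChartAt (𝓡 m) p).source) :
    Function.Surjective (fderiv ℝ (transition x p) z) := by
  refine (LinearMap.injective_iff_surjective
    (f := (fderiv ℝ (transition x p) z).toLinearMap)).1 ?_
  refine (injective_iff_map_eq_zero _).2 fun u hu => ?_
  by_contra h
  have h1 := chartForm_self_pos g hz h
  have h2 : fderiv ℝ (transition x p) z u = 0 := hu
  rw [chartForm_transition g hz hp, h2] at h1
  simp at h1

theorem comp_extChartAt_symm_eventuallyEq (f : M → ℝ) {x p : M} {z : 𝔼}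
    (hz : z ∈ (extChartAt (𝓡 m) x).target)
    (hp : (extChartAt (𝓡 m) x).symm z ∈ (extChartAt (𝓡 m) p).source) :
    f ∘ (extChartAt (𝓡 m) x).symm =ᶠ[𝓝 z]
      (f ∘ (extChartAt (𝓡 m) p).symm) ∘ transition x p := by
  filter_upwards [eventually_mem_source hz hp] with y hy
  exact congrArg f (extChartAt_symm_transition hy.2).symm

theorem fderiv_transition {f : M → ℝ} (hf : ContMDiff (𝓡 m) 𝓘(ℝ, ℝ) ∞ f) {x p : M} {z : 𝔼}
    (hz : z ∈ (extChartAt (𝓡 m) x).target)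
    (hp : (extChartAt (𝓡 m) x).symm z ∈ (extChartAt (𝓡 m) p).source) (u : 𝔼) :
    fderiv ℝ (f ∘ (extChartAt (𝓡 m) x).symm) z u =
      fderiv ℝ (f ∘ (extChartAt (𝓡 m) p).symm) (transition x p z)
        (fderiv ℝ (transition x p) z u) := by
  have hy : transition x p z ∈ (extChartAt (𝓡 m) p).target := (extChartAt (𝓡 m) p).map_source hp
  rw [(comp_extChartAt_symm_eventuallyEq f hz hp).fderiv_eq, fderiv_comp]
  · rfl
  · exact ((contDiffOn_comp_extChartAt_symm hf p).contDiffAt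
      ((isOpen_extChartAt_target p).mem_nhds hy)).differentiableAt (by simp)
  · exact (contDiffAt_transition hz hp).differentiableAt (by simp)

theorem traceHess_transition (h g : Metric m M) {f : M → ℝ} (hf : ContMDiff (𝓡 m) 𝓘(ℝ, ℝ) ∞ f)
    {x p : M} {z : 𝔼}
    (hz : z ∈ (extChartAt (𝓡 m) x).target)
    (hp : (extChartAt (𝓡 m) x).symm z ∈ (extChartAt (𝓡 m) p).source) :
    traceHess h g f x z = traceHess h g f p (transition x p z) := by
  have hy : transition x p z ∈ (extChartAt (𝓡 m) p).target := (extChartAt (𝓡 m) p).map_source hp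
  obtain ⟨n, hn⟩ := exists_chartForm_eq g hy
    (fderiv ℝ (f ∘ (extChartAt (𝓡 m) p).symm) (transition x p z))
  -- The gradient in the chart at `p` is the image of some vector `n`, which is then the gradient in
  -- the chart at `x`.
  obtain ⟨n, rfl⟩ := fderiv_transition_surjective g hz hp n
  have hn' : ∀ w, chartForm g x z n w = fderiv ℝ (f ∘ (extChartAt (𝓡 m) x).symm) z w := by
    intro w
    rw [chartForm_transition g hz hp, hn, fderiv_transition hf hz hp]
  have hgram : gram h x z = (endMatrix (fderiv ℝ (transition x p) z))ᵀ *
      gram h p (transition x p z) * endMatrix (fderiv ℝ (transition x p) z) := by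
    rw [← formMatrix_chartBilin, ← formMatrix_chartBilin]
    exact formMatrix_pullback (H := chartBilin h p (transition x p z)) (H' := chartBilin h x z)
      (L := fderiv ℝ (transition x p) z) fun u v => chartForm_transition h hz hp u v
  have hhess : ∀ u v, hessForm (chartForm g x) (f ∘ (extChartAt (𝓡 m) x).symm) z n u v =
      hessForm (chartForm g p) (f ∘ (extChartAt (𝓡 m) p).symm) (transition x p z)
        (fderiv ℝ (transition x p) z n) (fderiv ℝ (transition x p) z u)
        (fderiv ℝ (transition x p) z v) :=
    hessForm_pullback ((contDiffAt_transition hz hp).of_le (by norm_cast))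
      (differentiableAt_chartForm g hy) (chartForm_symm g p _) (differentiableAt_chartForm g hz)
      ((eventually_mem_source hz hp).mono fun y hy => chartForm_transition g hy.1 hy.2)
      (((contDiffOn_comp_extChartAt_symm hf p).contDiffAt
        ((isOpen_extChartAt_target p).mem_nhds hy)).of_le (by norm_cast))
      (comp_extChartAt_symm_eventuallyEq f hz hp) hn
  have hdet : IsUnit (endMatrix (fderiv ℝ (transition x p) z)).det := by
    have h1 := isUnit_det_gram h hz
    rw [hgram, det_mul] at h1
    exact isUnit_of_mul_isUnit_right h1
  simp only [traceHess, coordHess_eq_formMatrix g f hz hn', coordHess_eq_formMatrix g f hy hn]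
  rw [formMatrix_pullback hhess, hgram]
  exact sum_inv_mul_congr _ _ _ hdet

/-- Read in the same chart on both sides, the identity has Kronecker deltas as first derivatives and
zero second derivatives. -/
theorem secondFundForm_id (h g : Metric m M) (x : M) (γ i j : Fin m) :
    secondFundForm h g id x γ i j = christoffel g x γ i j (extChartAt (𝓡 m) x x) -
      christoffel h x γ i j (extChartAt (𝓡 m) x x) := by
  set y := extChartAt (𝓡 m) x x with hy
  set F : 𝔼 → 𝔼 := writtenInExtChartAt (𝓡 m) (𝓡 m) x (id : M → M) with hF
  have hy' : y ∈ (extChartAt (𝓡 m) x).target := mem_extChartAt_target x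
  have hFid : F =ᶠ[𝓝 y] id := by
    filter_upwards [(isOpen_extChartAt_target x).mem_nhds hy'] with z hz
    exact (extChartAt (𝓡 m) x).right_inv hz
  have hp : ∀ j γ : Fin m, pderiv j (fun z => F z γ) =ᶠ[𝓝 y] fun _ => if γ = j then 1 else 0 := by
    intro j γ
    have h1 : (fun z => F z γ) =ᶠ[𝓝 y] (EuclideanSpace.proj γ : 𝔼 →L[ℝ] ℝ) :=
      hFid.mono fun z hz => by simp [hz]
    filter_upwards [h1.fderiv (𝕜 := ℝ)] with z hz
    rw [pderiv, hz, ContinuousLinearMap.fderiv]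
    simp
  have hpp : pderiv i (pderiv j (fun z => F z γ)) y = 0 := by
    rw [pderiv, (hp j γ).fderiv_eq]
    simp
  have hFy : F y = y := hFid.eq_of_nhds
  simp only [secondFundForm, ← hF, ← hy, hpp, fun j γ => (hp j γ).eq_of_nhds, hFy]
  simp [neg_add_eq_sub]

variable (g : Metric m M) (f : M → ℝ) (hf : ContMDiff (𝓡 m) 𝓘(ℝ, ℝ) ∞ f)
  (hlt : ∀ x, g.inner x (grad g f x) (grad g f x) < 1)

/-- The components of the differential of `f` in the preferred chart at `p`. -/
def coordDiff (f : M → ℝ) (p : M) (y : 𝔼) (i : Fin m) : ℝ :=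
  fderiv ℝ (f ∘ (extChartAt (𝓡 m) p).symm) y (EuclideanSpace.single i 1)

/-- The key identity, with the Hessian of `g` but the gradient of the deformed metric. It combines
`koszul_sub_mul` for the symbols of the first kind with `inv_mulVec_sub_inv_mulVec` for raising the
index. -/
theorem christoffel_sub_christoffel_deform {p : M} {y : 𝔼}
    (hy : y ∈ (extChartAt (𝓡 m) p).target) (γ i j : Fin m) :
    christoffel g p γ i j y - christoffel (deform g f hf hlt) p γ i j y =
      coordHess g f p y i j * ((gram (deform g f hf hlt) p y)⁻¹ *ᵥ coordDiff f p y) γ := by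
  set F := f ∘ (extChartAt (𝓡 m) p).symm with hF
  have hmem := (isOpen_extChartAt_target p).mem_nhds hy
  have hFc : ContDiffAt ℝ 2 F y :=
    ((contDiffOn_comp_extChartAt_symm hf p).contDiffAt hmem).of_le (by norm_cast)
  have hk := koszul_sub_mul hFc (differentiableAt_chartForm g hy)
    (differentiableAt_chartForm (deform g f hf hlt) hy)
    (Filter.mem_of_superset hmem fun z hz => chartForm_deform g f hf hlt hz)
  have key := inv_mulVec_sub_inv_mulVec (isUnit_det_gram g hy)
    (isUnit_det_gram (deform g f hf hlt) hy) (d := coordDiff f p y)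
    (fun i j => chartForm_deform g f hf hlt hy _ _)
    (fun l => koszul (chartForm g p) y
      (EuclideanSpace.single i 1) (EuclideanSpace.single j 1) (EuclideanSpace.single l 1))
    (fderiv ℝ (fderiv ℝ F) y (EuclideanSpace.single i 1) (EuclideanSpace.single j 1))
  have key' := congrFun key γ
  have hdot : coordHess g f p y i j =
      fderiv ℝ (fderiv ℝ F) y (EuclideanSpace.single i 1) (EuclideanSpace.single j 1) -
      coordDiff f p y ⬝ᵥ (gram g p y)⁻¹ *ᵥ (fun l => koszul (chartForm g p) y
      (EuclideanSpace.single i 1) (EuclideanSpace.single j 1) (EuclideanSpace.single l 1)) := by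
    simp only [coordHess, christoffel_eq g hy, dotProduct, coordDiff, ← hF]
    congr 1
    exact Finset.sum_congr rfl fun k _ => mul_comm _ _
  rw [← hdot] at key'
  rw [christoffel_eq g hy, christoffel_eq _ hy]
  simp only [hk]
  exact key'

theorem tensionCoord_deform (x : M) (γ : Fin m) :
    tensionCoord (deform g f hf hlt) g id x γ =
      traceHess (deform g f hf hlt) g f x (extChartAt (𝓡 m) x x) *
        ((gram (deform g f hf hlt) x (extChartAt (𝓡 m) x x))⁻¹ *ᵥ
          coordDiff f x (extChartAt (𝓡 m) x x)) γ := by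
  simp only [tensionCoord, secondFundForm_id,
    christoffel_sub_christoffel_deform g f hf hlt (mem_extChartAt_target x), traceHess,
    Finset.sum_mul, mul_assoc]

theorem tension_deform_eq_zero_iff (x : M) :
    tension (deform g f hf hlt) g id x = 0 ↔
      fderiv ℝ (f ∘ (extChartAt (𝓡 m) x).symm) (extChartAt (𝓡 m) x x) = 0 ∨
        traceHess (deform g f hf hlt) g f x (extChartAt (𝓡 m) x x) = 0 := by
  set y := extChartAt (𝓡 m) x x with hy
  have h1 : tension (deform g f hf hlt) g id x = 0 ↔
      traceHess (deform g f hf hlt) g f x y •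
        ((gram (deform g f hf hlt) x y)⁻¹ *ᵥ coordDiff f x y) = 0 := by
    have : tensionCoord (deform g f hf hlt) g id x = traceHess (deform g f hf hlt) g f x y •
        ((gram (deform g f hf hlt) x y)⁻¹ *ᵥ coordDiff f x y) :=
      funext fun γ => tensionCoord_deform g f hf hlt x γ
    rw [← this]
    exact WithLp.toLp_eq_zero 2
  have h2 : coordDiff f x y = 0 ↔ fderiv ℝ (f ∘ (extChartAt (𝓡 m) x).symm) y = 0 := by
    refine ⟨fun h => ?_, fun h => ?_⟩
    · have h0 : ∀ i, fderiv ℝ (f ∘ (extChartAt (𝓡 m) x).symm) y (EuclideanSpace.single i 1) = 0 :=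
        congrFun h
      refine ContinuousLinearMap.ext fun u => ?_
      rw [← sum_smul_single u, map_sum, _root_.zero_apply]
      exact Finset.sum_eq_zero fun i _ => by rw [map_smul, h0, smul_zero]
    · ext i
      rw [coordDiff, h]
      rfl
  have hu := isUnit_det_gram (deform g f hf hlt) (mem_extChartAt_target (I := 𝓡 m) x)
  have h3 : (gram (deform g f hf hlt) x y)⁻¹ *ᵥ coordDiff f x y = 0 ↔ coordDiff f x y = 0 := by
    refine ⟨fun h => ?_, fun h => by rw [h, mulVec_zero]⟩
    have := congrArg (gram (deform g f hf hlt) x y *ᵥ ·) h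
    simp only [mulVec_mulVec, mulVec_zero] at this
    rwa [mul_nonsing_inv _ hu, one_mulVec] at this
  rw [h1, smul_eq_zero, h3, h2, or_comm]

end Tension

end RiemHarmonic

end

noncomputable section

namespace RiemHarmonic

open Set Filter Topology Matrix
open scoped MatrixOrder

/-! ### Applying the maximum principle on the manifold -/

section MaximumPrinciple

variable {m : ℕ} {M : Type*} [TopologicalSpace M] [ChartedSpace (EuclideanSpace ℝ (Fin m)) M]
  [IsManifold (𝓡 m) ∞ M]

local notation "𝔼" => EuclideanSpace ℝ (Fin m)

theorem continuousOn_inv_gram (g : Metric m M) (p : M) :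
    ContinuousOn (fun y => (gram g p y)⁻¹) (extChartAt (𝓡 m) p).target := by
  have hgram : ContinuousOn (gram g p) (extChartAt (𝓡 m) p).target := by
    refine continuousOn_pi.2 fun i => continuousOn_pi.2 fun j => ?_
    exact ((contDiffOn_chartForm g p).continuousOn.clm_apply continuousOn_const).clm_apply
      continuousOn_const
  simp only [Matrix.inv_def, Ring.inverse_eq_inv']
  refine ContinuousOn.smul (ContinuousOn.inv₀ ?_ fun y hy => (isUnit_det_gram g hy).ne_zero) ?_
  · exact continuous_id.matrix_det.comp_continuousOn hgram
  · exact continuous_id.matrix_adjugate.comp_continuousOn hgram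

theorem continuousOn_christoffel (g : Metric m M) (p : M) (k i j : Fin m) :
    ContinuousOn (christoffel g p k i j) (extChartAt (𝓡 m) p).target := by
  have hd := (contDiffOn_chartForm g p).continuousOn_fderiv_of_isOpen
    (isOpen_extChartAt_target p) (by simp)
  have hd3 : ∀ u v w : 𝔼, ContinuousOn (fun y => fderiv ℝ (chartForm g p) y u v w)
      (extChartAt (𝓡 m) p).target := fun u v w =>
    ((hd.clm_apply continuousOn_const).clm_apply continuousOn_const).clm_apply continuousOn_const
  refine ContinuousOn.congr ?_ fun y hy => christoffel_eq g hy k i j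
  simp only [mulVec, dotProduct]
  refine continuousOn_finsetSum _ fun l _ => ContinuousOn.fun_mul ?_ ?_
  · exact (continuous_apply_apply k l).comp_continuousOn (continuousOn_inv_gram g p)
  · exact continuousOn_const.mul (((hd3 _ _ _).add (hd3 _ _ _)).sub (hd3 _ _ _))

/-- The first order coefficients of `traceHess`. -/
def traceHessDrift (h g : Metric m M) (p : M) (y : 𝔼) : 𝔼 :=
  -∑ i, ∑ j, (gram h p y)⁻¹ i j • ∑ k, christoffel g p k i j y • EuclideanSpace.single k (1 : ℝ)

theorem continuousOn_traceHessDrift (h g : Metric m M) (p : M) :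
    ContinuousOn (traceHessDrift h g p) (extChartAt (𝓡 m) p).target := by
  refine ContinuousOn.neg (continuousOn_finsetSum _ fun i _ => continuousOn_finsetSum _ fun j _ =>
    ContinuousOn.fun_smul ?_ (continuousOn_finsetSum _ fun k _ =>
      (continuousOn_christoffel g p k i j).fun_smul continuousOn_const))
  exact (continuous_apply_apply i j).comp_continuousOn (continuousOn_inv_gram h p)

theorem traceHess_eq_ellipticOp (h g : Metric m M) (f : M → ℝ) (p : M) (y : 𝔼) :
    traceHess h g f p y = ellipticOp (fun y => (gram h p y)⁻¹) (traceHessDrift h g p)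
      (f ∘ (extChartAt (𝓡 m) p).symm) y := by
  simp only [traceHess, coordHess, ellipticOp, traceHessDrift, map_neg, map_sum, map_smul,
    smul_eq_mul, mul_sub, Finset.sum_sub_distrib]
  rw [sub_eq_add_neg]

variable (g : Metric m M) (f : M → ℝ) (hf : ContMDiff (𝓡 m) 𝓘(ℝ, ℝ) ∞ f)
  (hlt : ∀ x, g.inner x (grad g f x) (grad g f x) < 1)

/-- The equation of the tension field at the centres of the preferred charts, transported to an
arbitrary point of a chart. -/
theorem fderiv_eq_zero_or_traceHess_eq_zero
    (hten : ∀ x, tension (deform g f hf hlt) g id x = 0) {p : M} {y : 𝔼}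
    (hy : y ∈ (extChartAt (𝓡 m) p).target) :
    fderiv ℝ (f ∘ (extChartAt (𝓡 m) p).symm) y = 0 ∨
      traceHess (deform g f hf hlt) g f p y = 0 := by
  set x := (extChartAt (𝓡 m) p).symm y with hx
  have hxp : x ∈ (extChartAt (𝓡 m) p).source := (extChartAt (𝓡 m) p).map_target hy
  have hz : extChartAt (𝓡 m) x x ∈ (extChartAt (𝓡 m) x).target := mem_extChartAt_target x
  have hp : (extChartAt (𝓡 m) x).symm (extChartAt (𝓡 m) x x) ∈ (extChartAt (𝓡 m) p).source := by
    rwa [extChartAt_to_inv]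
  have hty : transition x p (extChartAt (𝓡 m) x x) = y := by
    rw [transition, extChartAt_to_inv]
    exact (extChartAt (𝓡 m) p).right_inv hy
  refine ((tension_deform_eq_zero_iff g f hf hlt x).1 (hten x)).imp (fun h => ?_) fun h => ?_
  · refine ContinuousLinearMap.ext fun w => ?_
    obtain ⟨u, rfl⟩ := fderiv_transition_surjective g hz hp w
    have := fderiv_transition hf hz hp u
    rw [h, hty] at this
    exact this.symm
  · rw [← hty, ← traceHess_transition _ g hf hz hp]
    exact h

/-- In the chart at `p` the leading matrix is the inverse Gram matrix of the deformed metric, hence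
positive definite, so Hopf's principle applies. -/
theorem eventually_eq_of_tension_eq_zero (hten : ∀ x, tension (deform g f hf hlt) g id x = 0)
    {p : M} (hmax : ∀ x, f x ≤ f p) : ∀ᶠ x in 𝓝 p, f x = f p := by
  have hFp : (f ∘ (extChartAt (𝓡 m) p).symm) (extChartAt (𝓡 m) p p) = f p :=
    congrArg f (extChartAt_to_inv p)
  have h := eventuallyEq_const_of_max (isOpen_extChartAt_target p)
    ((contDiffOn_comp_extChartAt_symm hf p).of_le (by norm_cast))
    (continuousOn_inv_gram (deform g f hf hlt) p) (fun y hy => (posDef_gram _ hy).inv)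
    (continuousOn_traceHessDrift (deform g f hf hlt) g p)
    (fun y hy => by
      rw [← traceHess_eq_ellipticOp]
      exact fderiv_eq_zero_or_traceHess_eq_zero g f hf hlt hten hy)
    (mem_extChartAt_target p) (fun y _ => by rw [hFp]; exact hmax _)
  rw [hFp] at h
  filter_upwards [(continuousAt_extChartAt (I := 𝓡 m) p).eventually h,
    extChartAt_source_mem_nhds (I := 𝓡 m) p] with x hx hxs
  rw [← hx, Function.comp_apply, (extChartAt (𝓡 m) p).left_inv hxs]

end MaximumPrinciple

end RiemHarmonic

end

open RiemHarmonic in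
theorem theorem3 {m : ℕ} {M : Type*} [TopologicalSpace M] [T2Space M] [CompactSpace M]
    [ConnectedSpace M] [ChartedSpace (EuclideanSpace ℝ (Fin m)) M] [IsManifold (𝓡 m) ∞ M]
    (g : Metric m M) (f : M → ℝ) (hf : ContMDiff (𝓡 m) 𝓘(ℝ, ℝ) ∞ f)
    (hlt : ∀ x, g.inner x (grad g f x) (grad g f x) < 1) :
    IsHarmonicMap (deform g f hf hlt) g (id : M → M) ↔ ∃ c : ℝ, ∀ x, f x = c := by
  constructor
  · rintro ⟨-, hten⟩
    have hcont : Continuous f := hf.continuous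
    obtain ⟨p, -, hp⟩ := isCompact_univ.exists_isMaxOn Set.univ_nonempty hcont.continuousOn
    have hmax : ∀ x, f x ≤ f p := fun x => hp (Set.mem_univ x)
    -- Each point where the maximum value is taken is itself a global maximum point, so the local
    -- statement applies there.
    have hopen : IsOpen {x | f x = f p} := by
      refine isOpen_iff_mem_nhds.2 fun q hq => ?_
      have hq : f q = f p := hq
      have h := eventually_eq_of_tension_eq_zero g f hf hlt hten (p := q)
        (by simpa only [hq] using hmax)
      exact h.mono fun x hx => hx.trans hq
    have hclopen : IsClopen {x | f x = f p} := ⟨isClosed_eq hcont continuous_const, hopen⟩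
    have huniv := hclopen.eq_univ ⟨p, rfl⟩
    exact ⟨f p, fun x => huniv.ge (Set.mem_univ x)⟩
  · rintro ⟨c, hc⟩
    refine ⟨contMDiff_id, fun x => (tension_deform_eq_zero_iff g f hf hlt x).2 (Or.inl ?_)⟩
    have : f ∘ (extChartAt (𝓡 m) x).symm = fun _ => c := funext fun y => hc _
    rw [this]
    simp
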